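/- Let $\Omega=\{x=(x_1,x_2,x_3)\in\mathbb{R}^3 : x_1^2+x_2^2>1\}$ be the exterior of the unit cylinder. For every $\bar\rho\ge 0$ there is a constant $C=C(\bar\rho)>0$, depending only on $\bar\rho$, such that the following holds. Let $\rho:\Omega\to\mathbb{R}$ be measurable with $0\le\rho\le\bar\rho$ almost everywhere in $\Omega$, and let $u\in H^1_0(\Omega;\mathbb{R}^3)$ (the closure of $C_0^\infty(\Omega;\mathbb{R}^3)$ in $H^1(\Omega;\mathbb{R}^3)$) be an axisymmetric vector field, i.e. for almost every $x\in\Omega$ $$u(x)=u^r(r,z)\,e_r+u^\theta(r,z)\,e_\theta+u^z(r,z)\,e_z$$ with components depending only on $r=\sqrt{x_1^2+x_2^2}$ and $z=x_3$, where $e_r=(x_1/r,x_2/r,0)$, $e_\theta=(-x_2/r,x_1/r,0)$, $e_z=(0,0,1)$. Then $\sqrt\rho\,u\in L^4(\Omega)$ and $$\|\sqrt{\rho}\,u\|_{L^4(\Omega)}^2\le C\left(1+\|\sqrt{\rho}\,u\|_{L^2(\Omega)}\right)\|u\|_{H^1(\Omega)}\sqrt{\ln\left(2+\|u\|_{H^1(\Omega)}^2\right)},$$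 where $\|u\|_{H^1(\Omega)}^2=\|u\|_{L^2(\Omega)}^2+\|\nabla u\|_{L^2(\Omega)}^2$. -/

import Mathlib

open MeasureTheory
open scoped ContDiff

noncomputable section

/-- Euclidean three-space; the coordinates `x₁, x₂, x₃` are `x 0, x 1, x 2`. -/
abbrev E3 : Type := EuclideanSpace ℝ (Fin 3)

/-- The exterior of the unit cylinder, `{x : x₁² + x₂² > 1}`. -/
def cylinderExterior : Set E3 := {x | 1 < x 0 ^ 2 + x 1 ^ 2}

/-- The space `C₀^∞(Ω)`: smooth functions whose support is a compact subset of `Ω`. -/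
def IsTestFunction {F : Type*} [NormedAddCommGroup F] [NormedSpace ℝ F]
    (Ω : Set E3) (φ : E3 → F) : Prop :=
  ContDiff ℝ ∞ φ ∧ HasCompactSupport φ ∧ tsupport φ ⊆ Ω

/-- The classical partial derivative `∂φ/∂xᵢ`. -/
def partialDeriv (i : Fin 3) (φ : E3 → ℝ) (x : E3) : ℝ :=
  fderiv ℝ φ x (EuclideanSpace.single i 1)

/-- `g` is a weak partial derivative `∂ᵢ u` on `Ω`: both are locally integrable on `Ω`, and
`∫_Ω u ∂ᵢφ = - ∫_Ω g φ` for all `φ ∈ C₀^∞(Ω)`. -/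
def HasWeakDeriv (Ω : Set E3) (i : Fin 3) (u g : E3 → E3) : Prop :=
  LocallyIntegrableOn u Ω volume ∧ LocallyIntegrableOn g Ω volume ∧
    ∀ φ : E3 → ℝ, IsTestFunction Ω φ →
      ∫ x in Ω, partialDeriv i φ x • u x = - ∫ x in Ω, φ x • g x

open Classical in
/-- The weak partial derivative `∂ᵢ u` on `Ω` (unique up to null sets; `0` if there is none). -/
def weakDeriv (Ω : Set E3) (i : Fin 3) (u : E3 → E3) : E3 → E3 :=
  if h : ∃ g : E3 → E3, HasWeakDeriv Ω i u g then h.choose else 0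

/-- `u ∈ H¹(Ω) = W^{1,2}(Ω)`: `u` and all its weak first derivatives are in `L²(Ω)`. -/
def MemH1 (Ω : Set E3) (u : E3 → E3) : Prop :=
  MemLp u 2 (volume.restrict Ω) ∧
    ∀ i : Fin 3, ∃ g : E3 → E3, HasWeakDeriv Ω i u g ∧ MemLp g 2 (volume.restrict Ω)

/-- The norm `‖u‖_{L^p(Ω)}`, meaningful for `u ∈ L^p(Ω)`. -/
def normLp (p : ENNReal) (Ω : Set E3) (u : E3 → E3) : ℝ :=
  lpNorm u p (volume.restrict Ω)

/-- The norm `‖u‖_{H¹(Ω)} = (‖u‖²_{L²(Ω)} + ‖∇u‖²_{L²(Ω)})^{1/2}`, meaningful for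
`u ∈ H¹(Ω)`. -/
def normH1 (Ω : Set E3) (u : E3 → E3) : ℝ :=
  Real.sqrt (normLp 2 Ω u ^ 2 + ∑ i : Fin 3, normLp 2 Ω (weakDeriv Ω i u) ^ 2)

/-- `u ∈ H¹₀(Ω)`: `u` belongs to the closure of `C₀^∞(Ω)` in `H¹(Ω)`. -/
def MemH10 (Ω : Set E3) (u : E3 → E3) : Prop :=
  MemH1 Ω u ∧
    ∀ ε : ℝ, 0 < ε → ∃ φ : E3 → E3, IsTestFunction Ω φ ∧ normH1 Ω (u - φ) < ε

/-- The cylindrical radius `r = (x₁² + x₂²)^{1/2}`. -/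
def cylRadius (x : E3) : ℝ := Real.sqrt (x 0 ^ 2 + x 1 ^ 2)

/-- The cylindrical unit vector `e_r = (cos θ, sin θ, 0)` at `x`, off the axis. -/
def eR (x : E3) : E3 := !₂[x 0 / cylRadius x, x 1 / cylRadius x, 0]

/-- The cylindrical unit vector `e_θ = (-sin θ, cos θ, 0)` at `x`, off the axis. -/
def eTheta (x : E3) : E3 := !₂[-(x 1) / cylRadius x, x 0 / cylRadius x, 0]

/-- The cylindrical unit vector `e_z = (0, 0, 1)`. -/
def eZ : E3 := !₂[0, 0, 1]

/-- The (almost everywhere defined) vector field `u` is axisymmetric on `Ω`: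
`u = u^r(r, z) e_r + u^θ(r, z) e_θ + u^z(r, z) e_z`, with components that are functions of
`(r, z)` only. -/
def IsAxisymmetric (Ω : Set E3) (u : E3 → E3) : Prop :=
  ∃ ur uθ uz : ℝ → ℝ → ℝ, ∀ᵐ x ∂(volume.restrict Ω),
    u x = ur (cylRadius x) (x 2) • eR x + uθ (cylRadius x) (x 2) • eTheta x
      + uz (cylRadius x) (x 2) • eZ

end

/-! Away from the axis an axisymmetric field is a function of two variables, so the planar embedding
of `W^{1,1}` into `L²` is available. Applied to truncations of `|u|`, it gives `‖h(|u|)‖_{L²} ≤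
‖h'(|u|) Γ‖_{L¹}`, where `Γ` is the sum of the `|∂ᵢu|`; this is `TruncationInequality`, proved for
`u` in `MemH10.truncationInequality`. The approximating test functions need not be axisymmetric. For
them the inequality is proved for integrals over the angle
(`IsTestFunction.lintegral_sq_angular_le`), and axisymmetry of the limit returns the pointwise
modulus.

A bound on `|u|` in `L⁴` alone would involve `‖u‖_{L²}`, not the weighted norm. The weight is kept
by splitting at a level `M`: where `|u| ≤ 2M`, one has `|√ρ u|⁴ ≤ 4 ρbar M² |√ρ u|²`; above, only
the unweighted excess `(|u| - M)₊` matters. It remains to make the excess harmless with `M² ~ H²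
ln(2 + H²)`, where `H` is the `H¹` norm.

Tent truncations bound the measure of one superlevel set by that of a lower one times the energy in
the band between. Iterating over `n` bands, whose energies sum to at most the total, yields
sub-Gaussian decay (`TruncationInequality.measure_tail`). The fourth moment of the excess is at most
the squared energy times the measure of the superlevel set (`fourth_moment_le`). Taking `n ~ ln(2 +
H²)` makes that measure small enough to cancel the surplus powers of `H` (`exists_level`). -/

noncomputable section

/-! ### Tail and moment estimates from truncated Sobolev inequalities -/

/-- Cauchy–Schwarz for nonnegative integrals. -/
theorem sq_lintegral_mul_le {α : Type*} [MeasurableSpace α] {μ : Measure α}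
    {f g : α → ENNReal} (hf : AEMeasurable f μ) (hg : AEMeasurable g μ) :
    (∫⁻ x, f x * g x ∂μ) ^ 2 ≤ (∫⁻ x, f x ^ 2 ∂μ) * ∫⁻ x, g x ^ 2 ∂μ := by
  have h := ENNReal.lintegral_mul_le_Lp_mul_Lq μ Real.HolderConjugate.two_two hf hg
  have h2 := pow_le_pow_left' h 2
  simp only [Pi.mul_apply, ENNReal.rpow_two] at h2
  refine h2.trans (le_of_eq ?_)
  rw [mul_pow, ← ENNReal.rpow_natCast, ← ENNReal.rpow_natCast, ← ENNReal.rpow_mul,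
    ← ENNReal.rpow_mul]
  norm_num

/-- The rising ramp over `[a, c]` is a triangle of this area, and the rest of `k` only adds to it.
It serves both the tent and the half-line truncation. -/
theorem sq_half_le_integral {k : ℝ → ℝ} (hk : Continuous k) (h0 : ∀ s, 0 ≤ k s) {a c s : ℝ}
    (ha : 0 ≤ a) (hac : a ≤ c) (hcs : c ≤ s) (hkac : ∀ t ∈ Set.Icc a c, k t = t - a) :
    (c - a) ^ 2 / 2 ≤ ∫ t in (0 : ℝ)..s, k t := by
  have h1 : ∫ t in a..c, k t = (c - a) ^ 2 / 2 := by
    have : ∫ t in a..c, k t = ∫ t in a..c, (t - a) :=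
      intervalIntegral.integral_congr fun t ht => hkac t (by rwa [Set.uIcc_of_le hac] at ht)
    rw [this, intervalIntegral.integral_comp_sub_right (fun t => t) a, integral_id]
    ring
  rw [← h1]
  exact intervalIntegral.integral_mono_interval ha hac hcs
    (Filter.Eventually.of_forall h0) (hk.intervalIntegrable _ _)

/-- The inequality `‖h(U)‖_{L²} ≤ ‖h'(U) Γ‖_{L¹}` for primitives `h` of Lipschitz functions that
vanish near the origin: the two-dimensional Sobolev inequality with `Γ` in the role of `|∇U|`. -/
def TruncationInequality {α : Type*} [MeasurableSpace α] (μ : Measure α) (U : α → ℝ)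
    (Γ : α → ENNReal) : Prop :=
  ∀ (k : ℝ → ℝ) (K : NNReal) (a : ℝ), 0 < a → LipschitzWith K k → (∀ s, 0 ≤ k s) →
    (∀ s ≤ a, k s = 0) →
    ∫⁻ x, ENNReal.ofReal (∫ t in (0 : ℝ)..U x, k t) ^ 2 ∂μ ≤
      (∫⁻ x, ENNReal.ofReal (k (U x)) * Γ x ∂μ) ^ 2

section Tail

variable {α : Type*} [MeasurableSpace α] {μ : Measure α} {U : α → ℝ} {Γ : α → ENNReal}

/-- Test with the tent over `[a, b]`. Its primitive is at least `(b - a)² / 8` on `{b ≤ U}`, while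
its height `(b - a) / 2` and Cauchy–Schwarz on the band bound the right side; the quotient of the
constants is 16. -/
theorem TruncationInequality.measure_step (h : TruncationInequality μ U Γ) (hU : Measurable U)
    (hΓ : AEMeasurable Γ μ) {a b : ℝ} (ha : 0 < a) (hab : a < b) :
    ENNReal.ofReal ((b - a) ^ 2) * μ {x | b ≤ U x} ≤
      16 * (μ {x | a ≤ U x} * ∫⁻ x in {x | a < U x ∧ U x < b}, Γ x ^ 2 ∂μ) := by
  set k : ℝ → ℝ := fun s => max 0 (min (s - a) (b - s)) with hk
  have hkL : LipschitzWith 1 k := by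
    have h1 : LipschitzWith 1 fun s : ℝ => s - a := by
      simpa using LipschitzWith.id.sub (LipschitzWith.const a)
    have h2 : LipschitzWith 1 fun s : ℝ => b - s := by
      simpa using (LipschitzWith.const b).sub LipschitzWith.id
    simpa using (h1.min h2).const_max 0
  have hk0 : ∀ s, 0 ≤ k s := fun s => le_max_left _ _
  have hkz : ∀ s, ¬ (a < s ∧ s < b) → k s = 0 := by
    intro s hs
    refine max_eq_left ?_
    by_contra! hcon
    exact hs ⟨by linarith [(lt_min_iff.1 hcon).1], by linarith [(lt_min_iff.1 hcon).2]⟩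
  have hkle : ∀ s, k s ≤ (b - a) / 2 := by
    intro s
    refine max_le (by linarith) ?_
    rcases le_total s ((a + b) / 2) with hs | hs
    · exact (min_le_left _ _).trans (by linarith)
    · exact (min_le_right _ _).trans (by linarith)
  have key := h k 1 a ha hkL hk0 (fun s hs => hkz s (by intro hh; linarith [hh.1]))
  have hSm : MeasurableSet {x | a < U x ∧ U x < b} :=
    (measurableSet_lt measurable_const hU).inter (measurableSet_lt hU measurable_const)
  have hlow : ENNReal.ofReal ((b - a) ^ 2 / 8) ^ 2 * μ {x | b ≤ U x} ≤
      ∫⁻ x, ENNReal.ofReal (∫ t in (0 : ℝ)..U x, k t) ^ 2 ∂μ := by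
    rw [← setLIntegral_const]
    refine (setLIntegral_mono_ae' (measurableSet_le measurable_const hU) ?_).trans
      (setLIntegral_le_lintegral _ _)
    refine Filter.Eventually.of_forall fun x hx => ?_
    refine pow_le_pow_left' (ENNReal.ofReal_le_ofReal ?_) 2
    have := sq_half_le_integral (k := k) hkL.continuous hk0 (a := a) (c := (a + b) / 2)
      (s := U x) ha.le (by linarith) (by linarith [show b ≤ U x from hx]) (by
        intro t ht
        simp only [hk]
        rw [min_eq_left (by linarith [ht.2]), max_eq_right (by linarith [ht.1])])
    refine le_trans (le_of_eq ?_) this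
    ring
  have hup : (∫⁻ x, ENNReal.ofReal (k (U x)) * Γ x ∂μ) ^ 2 ≤
      (ENNReal.ofReal ((b - a) / 2) ^ 2 * μ {x | a ≤ U x}) *
        ∫⁻ x in {x | a < U x ∧ U x < b}, Γ x ^ 2 ∂μ := by
    have heq : ∫⁻ x, ENNReal.ofReal (k (U x)) * Γ x ∂μ =
        ∫⁻ x in {x | a < U x ∧ U x < b}, ENNReal.ofReal (k (U x)) * Γ x ∂μ := by
      rw [← lintegral_indicator hSm]
      refine lintegral_congr fun x => ?_
      by_cases hx : x ∈ {x | a < U x ∧ U x < b}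
      · rw [Set.indicator_of_mem hx]
      · rw [Set.indicator_of_notMem hx, hkz _ hx]; simp
    rw [heq]
    refine (sq_lintegral_mul_le
      (hkL.continuous.measurable.comp hU).ennreal_ofReal.aemeasurable hΓ.restrict).trans ?_
    gcongr
    rw [← setLIntegral_const]
    refine (lintegral_mono_set (fun x hx => le_of_lt hx.1)).trans ?_
    exact lintegral_mono fun x => pow_le_pow_left' (ENNReal.ofReal_le_ofReal (hkle _)) 2
  have hall := hlow.trans (key.trans hup)
  have hd : 0 < b - a := by linarith
  have e1 : ENNReal.ofReal ((b - a) ^ 2 / 8) ^ 2 =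
      ENNReal.ofReal ((b - a) ^ 2 / 64) * ENNReal.ofReal ((b - a) ^ 2) := by
    rw [← ENNReal.ofReal_pow (by positivity), ← ENNReal.ofReal_mul (by positivity)]
    congr 1; ring
  have e2 : ENNReal.ofReal ((b - a) / 2) ^ 2 = ENNReal.ofReal ((b - a) ^ 2 / 64) * 16 := by
    rw [← ENNReal.ofReal_pow (by positivity), ← ENNReal.ofReal_ofNat 16,
      ← ENNReal.ofReal_mul (by positivity)]
    congr 1; ring
  rw [e1, e2, mul_assoc, mul_assoc, mul_assoc] at hall
  refine (ENNReal.mul_le_mul_iff_right ?_ ENNReal.ofReal_ne_top).1 hall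
  simp only [ne_eq, ENNReal.ofReal_eq_zero, not_le]
  positivity

/-- AM–GM with equal weights. The factor `n⁻ⁿ` gained here is what yields Gaussian rather than
merely exponential decay. -/
theorem prod_le_sum_div_pow {n : ℕ} (hn : 1 ≤ n) (e : ℕ → ℝ) (he : ∀ j, 0 ≤ e j) {D : ℝ}
    (hD : ∑ j ∈ Finset.range n, e j ≤ D) : ∏ j ∈ Finset.range n, e j ≤ (D / n) ^ n := by
  have hn' : (0 : ℝ) < n := by exact_mod_cast hn
  have h := Real.geom_mean_le_arith_mean_weighted (Finset.range n) (fun _ => (1 : ℝ) / n) e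
    (fun _ _ => by positivity) (by simp [hn'.ne']) (fun j _ => he j)
  rw [Real.finsetProd_rpow _ _ (fun j _ => he j), ← Finset.mul_sum] at h
  have hP : 0 ≤ ∏ j ∈ Finset.range n, e j := Finset.prod_nonneg fun j _ => he j
  have h2 := pow_le_pow_left₀ (Real.rpow_nonneg hP _) h n
  rw [← Real.rpow_natCast (_ ^ _) n, ← Real.rpow_mul hP, one_div,
    inv_mul_cancel₀ hn'.ne', Real.rpow_one] at h2
  refine h2.trans (pow_le_pow_left₀ ?_ ?_ n)
  · have := Finset.sum_nonneg fun j (_ : j ∈ Finset.range n) => he j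
    positivity
  · rw [div_eq_inv_mul]; gcongr

theorem measure_superlevel_le (hU : Measurable U) {B : ℝ}
    (hB : ∫⁻ x, ENNReal.ofReal (U x) ^ 2 ∂μ ≤ ENNReal.ofReal B) {s : ℝ} (hs : 0 < s) :
    μ {x | s ≤ U x} ≤ ENNReal.ofReal (B / s ^ 2) := by
  have h1 := mul_meas_ge_le_lintegral (μ := μ) (hU.ennreal_ofReal.pow_const 2)
    (ENNReal.ofReal (s ^ 2))
  have hsub : {x | s ≤ U x} ⊆ {x | ENNReal.ofReal (s ^ 2) ≤ ENNReal.ofReal (U x) ^ 2} := by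
    intro x hx
    change s ≤ U x at hx
    change ENNReal.ofReal (s ^ 2) ≤ ENNReal.ofReal (U x) ^ 2
    rw [ENNReal.ofReal_pow hs.le]
    exact pow_le_pow_left' (ENNReal.ofReal_le_ofReal hx) 2
  have h2 : ENNReal.ofReal (s ^ 2) * μ {x | s ≤ U x} ≤ ENNReal.ofReal B :=
    (mul_le_mul_right (measure_mono hsub) _).trans (h1.trans hB)
  rw [ENNReal.ofReal_div_of_pos (by positivity), ENNReal.le_div_iff_mul_le]
  · rwa [mul_comm]
  · left; simp only [ne_eq, ENNReal.ofReal_eq_zero, not_le]; positivity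
  · left; exact ENNReal.ofReal_ne_top

/-- Sub-Gaussian decay of the distribution function. -/
theorem TruncationInequality.measure_tail (h : TruncationInequality μ U Γ) (hU : Measurable U)
    (hΓ : AEMeasurable Γ μ) {B D : ℝ} (hB0 : 0 ≤ B) (hD0 : 0 ≤ D)
    (hB : ∫⁻ x, ENNReal.ofReal (U x) ^ 2 ∂μ ≤ ENNReal.ofReal B)
    (hD : ∫⁻ x, Γ x ^ 2 ∂μ ≤ ENNReal.ofReal D) {n : ℕ} (hn : 1 ≤ n) {s : ℝ} (hs : 0 < s) :
    μ {x | s ≤ U x} ≤ ENNReal.ofReal (4 * B / s ^ 2 * (64 * n * D / s ^ 2) ^ n) := by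
  have hn' : (0 : ℝ) < n := by exact_mod_cast hn
  -- The interval `[s/2, s]` is cut into `n` equal layers. Starting at `s/2` keeps every level
  -- positive and lets Chebyshev bound the first superlevel set by `4B / s²`.
  set d : ℝ := s / (2 * n) with hd
  have hd0 : 0 < d := by positivity
  set a : ℕ → ℝ := fun j => s / 2 + j * d with ha
  have ha0 : ∀ j, 0 < a j := fun j => by positivity
  have hastep : ∀ j, a (j + 1) - a j = d := fun j => by simp only [ha]; push_cast; ring
  have halt : ∀ j, a j < a (j + 1) := fun j => by linarith [hastep j]
  have hmono : StrictMono a := strictMono_nat_of_lt_succ halt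
  set S : ℕ → Set α := fun j => {x | a j < U x ∧ U x < a (j + 1)} with hS
  have hSm : ∀ j, MeasurableSet (S j) := fun j =>
    (measurableSet_lt measurable_const hU).inter (measurableSet_lt hU measurable_const)
  have hdisj : Pairwise (Function.onFun Disjoint S) := by
    refine (pairwise_disjoint_on S).2 fun i j hij => ?_
    refine Set.disjoint_left.2 fun x hx hx' => ?_
    have := hmono.monotone (show i + 1 ≤ j from hij)
    linarith [hx.2, hx'.1]
  set e : ℕ → ℝ := fun j => (∫⁻ x in S j, Γ x ^ 2 ∂μ).toReal with he
  have hfin : ∀ j, ∫⁻ x in S j, Γ x ^ 2 ∂μ ≠ ⊤ := fun j =>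
    ne_top_of_le_ne_top ENNReal.ofReal_ne_top ((setLIntegral_le_lintegral _ _).trans hD)
  -- The bands are disjoint, so their energies share one total budget.
  have hsum : ∑ j ∈ Finset.range n, e j ≤ D := by
    rw [← ENNReal.toReal_sum fun j _ => hfin j]
    refine ENNReal.toReal_le_of_le_ofReal hD0 (le_trans ?_ hD)
    rw [← lintegral_biUnion_finset (fun i _ j _ hij => hdisj hij) fun j _ => hSm j]
    exact setLIntegral_le_lintegral _ _
  set m : ℕ → ℝ := fun j => (μ {x | a j ≤ U x}).toReal with hm
  have hmfin : ∀ j, μ {x | a j ≤ U x} ≠ ⊤ := fun j =>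
    ne_top_of_le_ne_top ENNReal.ofReal_ne_top (measure_superlevel_le hU hB (ha0 j))
  have hstep : ∀ j, d ^ 2 * m (j + 1) ≤ 16 * (m j * e j) := by
    intro j
    have h1 := h.measure_step hU hΓ (ha0 j) (halt j)
    rw [hastep j] at h1
    have h2 := ENNReal.toReal_mono (ENNReal.mul_ne_top (by norm_num)
      (ENNReal.mul_ne_top (hmfin j) (hfin j))) h1
    simpa [ENNReal.toReal_mul, ENNReal.toReal_ofReal (sq_nonneg d), hm, he, hS] using h2
  have he0 : ∀ j, 0 ≤ e j := fun j => ENNReal.toReal_nonneg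
  have hiter : ∀ i, (d ^ 2) ^ i * m i ≤ 16 ^ i * m 0 * ∏ j ∈ Finset.range i, e j := by
    intro i
    induction i with
    | zero => simp
    | succ i ih =>
      rw [Finset.prod_range_succ]
      calc (d ^ 2) ^ (i + 1) * m (i + 1) = (d ^ 2) ^ i * (d ^ 2 * m (i + 1)) := by ring
        _ ≤ (d ^ 2) ^ i * (16 * (m i * e i)) := mul_le_mul_of_nonneg_left (hstep i) (by positivity)
        _ = 16 * ((d ^ 2) ^ i * m i) * e i := by ring
        _ ≤ 16 * (16 ^ i * m 0 * ∏ j ∈ Finset.range i, e j) * e i :=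
          mul_le_mul_of_nonneg_right (mul_le_mul_of_nonneg_left ih (by norm_num)) (he0 i)
        _ = _ := by ring
  have hm0 : m 0 ≤ 4 * B / s ^ 2 := by
    have h1 := ENNReal.toReal_le_of_le_ofReal (by positivity)
      (measure_superlevel_le hU hB (ha0 0))
    refine h1.trans (le_of_eq ?_)
    simp only [ha]
    field_simp
    norm_num
  have han : a n = s := by simp only [ha, hd]; field_simp; ring
  have hmn : m n ≤ 4 * B / s ^ 2 * (64 * n * D / s ^ 2) ^ n := by
    have h1 : (d ^ 2) ^ n * m n ≤ 16 ^ n * (4 * B / s ^ 2) * (D / n) ^ n :=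
      (hiter n).trans (by
        gcongr
        exact prod_le_sum_div_pow hn e he0 hsum)
    have h2 : 16 ^ n * (4 * B / s ^ 2) * (D / n) ^ n =
        (d ^ 2) ^ n * (4 * B / s ^ 2 * (64 * n * D / s ^ 2) ^ n) := by
      have : (16 : ℝ) * (D / n) = d ^ 2 * (64 * n * D / s ^ 2) := by
        simp only [hd]; field_simp; ring
      calc _ = (4 * B / s ^ 2) * (16 * (D / n)) ^ n := by rw [mul_pow]; ring
        _ = _ := by rw [this, mul_pow]; ring
    rw [h2] at h1
    exact le_of_mul_le_mul_left h1 (by positivity)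
  rw [← han, ← ENNReal.ofReal_toReal (hmfin n)]
  rw [han]
  refine ENNReal.ofReal_le_ofReal ?_
  simpa [hm, han] using hmn

/-- The fourth moment above a high level is controlled by the measure of the superlevel set. -/
theorem TruncationInequality.fourth_moment_le (h : TruncationInequality μ U Γ)
    (hU : Measurable U) (hΓ : AEMeasurable Γ μ) {B D : ℝ}
    (hB : ∫⁻ x, ENNReal.ofReal (U x) ^ 2 ∂μ ≤ ENNReal.ofReal B)
    (hD : ∫⁻ x, Γ x ^ 2 ∂μ ≤ ENNReal.ofReal D) {M : ℝ} (hM : 0 < M) :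
    ∫⁻ x, ENNReal.ofReal (U x - M) ^ 4 ∂μ ≤
      16 * ENNReal.ofReal D ^ 2 * μ {x | M ≤ U x} := by
  set k : ℝ → ℝ := fun s => max 0 (s - M) with hk
  have hkL : LipschitzWith 1 k := by
    have h1 : LipschitzWith 1 fun s : ℝ => s - M := by
      simpa using LipschitzWith.id.sub (LipschitzWith.const M)
    simpa using h1.const_max 0
  have hk0 : ∀ s, 0 ≤ k s := fun s => le_max_left _ _
  have hkof : ∀ s, ENNReal.ofReal (k s) = ENNReal.ofReal (s - M) := by
    intro s
    simp [hk, ENNReal.ofReal_max]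
  have key := h k 1 M hM hkL hk0 (fun s hs => max_eq_left (by linarith))
  simp only [hkof] at key
  have hmeas : Measurable fun x => ENNReal.ofReal (U x - M) :=
    (hU.sub_const M).ennreal_ofReal
  set X := ∫⁻ x, ENNReal.ofReal (U x - M) ^ 4 ∂μ with hX
  set Y := ∫⁻ x, ENNReal.ofReal (U x - M) ^ 2 ∂μ with hY
  have hlow : X ≤ 4 * ∫⁻ x, ENNReal.ofReal (∫ t in (0 : ℝ)..U x, k t) ^ 2 ∂μ := by
    rw [← lintegral_const_mul' _ _ (by norm_num)]
    refine lintegral_mono fun x => ?_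
    rcases le_total (U x) M with hx | hx
    · rw [ENNReal.ofReal_of_nonpos (by linarith)]; simp
    have := sq_half_le_integral (k := k) hkL.continuous hk0 hM.le hx le_rfl
      (fun t ht => max_eq_right (by linarith [ht.1]))
    have h2 : ENNReal.ofReal (U x - M) ^ 4 =
        4 * ENNReal.ofReal ((U x - M) ^ 2 / 2) ^ 2 := by
      rw [← ENNReal.ofReal_pow (by linarith), ← ENNReal.ofReal_pow (by positivity),
        ← ENNReal.ofReal_ofNat 4, ← ENNReal.ofReal_mul (by norm_num)]
      congr 1; ring
    simp only
    rw [h2]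
    gcongr
  have hXY : X ≤ 4 * (Y * ENNReal.ofReal D) := by
    refine hlow.trans (mul_le_mul_right (key.trans ?_) _)
    refine (sq_lintegral_mul_le hmeas.aemeasurable hΓ).trans ?_
    gcongr
  have hYB : Y ≤ ENNReal.ofReal B := by
    refine le_trans (lintegral_mono fun x => ?_) hB
    exact pow_le_pow_left' (ENNReal.ofReal_le_ofReal (by linarith)) 2
  -- Finiteness is what permits cancelling one factor `X` at the end; it comes from the second
  -- moment bound.
  have hXfin : X ≠ ⊤ := by
    refine ne_top_of_le_ne_top ?_ hXY
    exact ENNReal.mul_ne_top (by norm_num) (ENNReal.mul_ne_top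
      (ne_top_of_le_ne_top ENNReal.ofReal_ne_top hYB) ENNReal.ofReal_ne_top)
  have hSm : MeasurableSet {x | M ≤ U x} := measurableSet_le measurable_const hU
  -- Cauchy–Schwarz against the indicator of the superlevel set. Together with `hXY` this closes up
  -- as `X² ≤ 16 D² X μ{M ≤ U}`.
  have hYX : Y ^ 2 ≤ X * μ {x | M ≤ U x} := by
    have h1 := sq_lintegral_mul_le (μ := μ) (f := fun x => ENNReal.ofReal (U x - M) ^ 2)
      (g := Set.indicator {x | M ≤ U x} 1) (hmeas.pow_const 2).aemeasurable
      (measurable_one.indicator hSm).aemeasurable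
    have h2 : ∫⁻ x, Set.indicator {x | M ≤ U x} (1 : α → ENNReal) x ^ 2 ∂μ =
        μ {x | M ≤ U x} := by
      rw [← lintegral_indicator_one hSm]
      refine lintegral_congr fun x => ?_
      by_cases hx : x ∈ {x | M ≤ U x} <;> simp [hx]
    rw [h2] at h1
    have h3 : ∫⁻ x, ENNReal.ofReal (U x - M) ^ 2 * Set.indicator {x | M ≤ U x} 1 x ∂μ = Y := by
      refine lintegral_congr fun x => ?_
      by_cases hx : x ∈ {x | M ≤ U x}
      · simp [hx]
      · have : U x - M ≤ 0 := by simp at hx; linarith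
        rw [ENNReal.ofReal_of_nonpos this]; simp
    rw [h3] at h1
    refine h1.trans (le_of_eq ?_)
    congr 1
    exact lintegral_congr fun x => by rw [← pow_mul]
  rcases eq_or_ne X 0 with h0 | h0
  · rw [h0]; exact zero_le
  refine (ENNReal.mul_le_mul_iff_right h0 hXfin).1 ?_
  calc X * X = X ^ 2 := (sq X).symm
    _ ≤ (4 * (Y * ENNReal.ofReal D)) ^ 2 := pow_le_pow_left' hXY 2
    _ = 16 * ENNReal.ofReal D ^ 2 * Y ^ 2 := by ring
    _ ≤ 16 * ENNReal.ofReal D ^ 2 * (X * μ {x | M ≤ U x}) := by gcongr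
    _ = _ := by ring

end Tail

/-! ### Truncated norms along curves -/

/-- A truncated norm increases along a curve at most at the rate of the truncated speed. -/
theorem integral_norm_le_integral_along_curve {k : ℝ → ℝ} (hk : Continuous k)
    (h0 : ∀ s, 0 ≤ k s) {a : ℝ} (ha : 0 < a) (hka : ∀ s ≤ a, k s = 0) {γ : ℝ → E3}
    (hγ : ContDiff ℝ 1 γ) {c t : ℝ} (hct : c ≤ t) (hc : γ c = 0) :
    ∫ s in (0 : ℝ)..‖γ t‖, k s ≤ ∫ s in c..t, k ‖γ s‖ * ‖deriv γ s‖ := by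
  set h : ℝ → ℝ := fun y => ∫ s in (0 : ℝ)..y, k s with hh
  have hder : ∀ y, HasDerivAt h (k y) y := fun y =>
    intervalIntegral.integral_hasDerivAt_right (hk.intervalIntegrable _ _)
      (hk.stronglyMeasurableAtFilter _ _) hk.continuousAt
  have hγd : ∀ s, HasDerivAt γ (deriv γ s) s := fun s =>
    (hγ.differentiable one_ne_zero s).hasDerivAt
  have hγc : Continuous γ := hγ.continuous
  have hdc : Continuous (deriv γ) := hγ.continuous_deriv le_rfl
  have hhz : ∀ y, y ≤ a → h y = 0 := by
    intro y hy
    have : ∫ s in (0 : ℝ)..y, k s = ∫ s in (0 : ℝ)..y, (0 : ℝ) := by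
      refine intervalIntegral.integral_congr fun s hs => hka s ?_
      rcases Set.mem_uIcc.1 hs with hs | hs <;> linarith [hs.1, hs.2]
    simp only [hh, this, intervalIntegral.integral_zero]
  have hex : ∀ s, ∃ d, HasDerivAt (fun s => h ‖γ s‖) d s ∧ d ≤ k ‖γ s‖ * ‖deriv γ s‖ := by
    intro s
    -- The norm is not differentiable at the origin, but `k` vanishes up to `a > 0`, so the
    -- primitive is flat there and the composite is locally zero.
    by_cases hs : γ s = 0
    · refine ⟨0, ?_, mul_nonneg (h0 _) (norm_nonneg _)⟩
      have hev : (fun s => h ‖γ s‖) =ᶠ[nhds s] fun _ => 0 := by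
        have : Filter.Tendsto (fun s => ‖γ s‖) (nhds s) (nhds 0) := by
          have := hγc.norm.tendsto s
          rwa [hs, norm_zero] at this
        filter_upwards [this.eventually_lt_const ha] with r hr using hhz _ hr.le
      exact (hasDerivAt_const s (0 : ℝ)).congr_of_eventuallyEq hev
    · have hn : DifferentiableAt ℝ (fun s => ‖γ s‖) s :=
        (hγd s).differentiableAt.norm ℝ hs
      have hle : deriv (fun s => ‖γ s‖) s ≤ ‖deriv γ s‖ := by
        refine (le_abs_self _).trans ?_
        have hcomp : deriv (fun s => ‖γ s‖) s = fderiv ℝ (fun y : E3 => ‖y‖) (γ s) (deriv γ s) :=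
          fderiv_comp_deriv s (differentiableAt_id.norm ℝ hs) (hγd s).differentiableAt
        rw [hcomp, ← Real.norm_eq_abs]
        refine ((fderiv ℝ (fun y : E3 => ‖y‖) (γ s)).le_opNorm _).trans ?_
        have := norm_fderiv_le_of_lipschitz ℝ (lipschitzWith_one_norm (E := E3)) (x₀ := γ s)
        exact mul_le_of_le_one_left (norm_nonneg _) (by simpa using this)
      exact ⟨_, (hder _).comp s hn.hasDerivAt, mul_le_mul_of_nonneg_left hle (h0 _)⟩
  choose g' hg' hle using hex
  have hcont : Continuous fun s => k ‖γ s‖ * ‖deriv γ s‖ :=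
    (hk.comp hγc.norm).mul hdc.norm
  -- This comparison asks integrability only of the dominating function, so the chosen derivative
  -- `g'` needs no regularity.
  have := intervalIntegral.sub_le_integral_of_hasDeriv_right_of_le hct
    (fun s _ => (hg' s).continuousAt.continuousWithinAt)
    (fun s _ => (hg' s).hasDerivWithinAt) hcont.integrableOn_Icc (fun s _ => hle s)
  rw [hc, norm_zero] at this
  simpa [hhz 0 ha.le] using this

/-! ### Cylindrical coordinates -/

/-- The point with cylindrical coordinates `(r, θ, z)`. -/
def cylPoint (r θ z : ℝ) : E3 := !₂[r * Real.cos θ, r * Real.sin θ, z]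

theorem continuous_cylPoint : Continuous fun p : ℝ × ℝ × ℝ => cylPoint p.1 p.2.1 p.2.2 := by
  unfold cylPoint
  refine (PiLp.continuous_toLp 2 _).comp (continuous_pi fun i => ?_)
  fin_cases i <;> simp <;> fun_prop

theorem lintegral_e3 {f : E3 → ENNReal} (hf : Measurable f) :
    ∫⁻ x, f x = ∫⁻ z : ℝ, ∫⁻ p : ℝ × ℝ, f !₂[p.1, p.2, z] := by
  have h1 := (volume_preserving_piFinSuccAbove (fun _ : Fin 3 => ℝ) 2).symm
  have h2 := (volume_preserving_finTwoArrow ℝ).symm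
  have h3 := PiLp.volume_preserving_toLp (Fin 3)
  have h4 := h3.comp (h1.comp ((MeasurePreserving.id (volume : Measure ℝ)).prod h2))
  rw [← h4.lintegral_comp hf, lintegral_prod]
  · refine lintegral_congr fun z => lintegral_congr fun p => ?_
    congr 1
    ext i
    fin_cases i <;> rfl
  · exact (hf.comp h4.measurable).aemeasurable

theorem cylPoint_mem_iff {r θ z : ℝ} (hr : 0 < r) :
    cylPoint r θ z ∈ cylinderExterior ↔ 1 < r := by
  have : (r * Real.cos θ) ^ 2 + (r * Real.sin θ) ^ 2 = r ^ 2 := by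
    rw [mul_pow, mul_pow, ← mul_add, Real.cos_sq_add_sin_sq, mul_one]
  simp only [cylinderExterior, cylPoint]
  change 1 < (r * Real.cos θ) ^ 2 + (r * Real.sin θ) ^ 2 ↔ 1 < r
  rw [this, one_lt_sq_iff₀ hr.le]

theorem isOpen_cylinderExterior : IsOpen cylinderExterior := by
  unfold cylinderExterior
  exact isOpen_lt continuous_const (by fun_prop)

/-- Integration over the exterior of the cylinder in cylindrical coordinates. -/
theorem lintegral_cylinderExterior {f : E3 → ENNReal} (hf : Measurable f) :
    ∫⁻ x in cylinderExterior, f x =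
      ∫⁻ z : ℝ, ∫⁻ r in Set.Ioi (1 : ℝ), ∫⁻ θ in Set.Ioo (-Real.pi) Real.pi,
        ENNReal.ofReal r * f (cylPoint r θ z) := by
  have hΩ := isOpen_cylinderExterior.measurableSet
  have hF : Measurable (cylinderExterior.indicator f) := hf.indicator hΩ
  rw [← lintegral_indicator hΩ, lintegral_e3 hF]
  refine lintegral_congr fun z => ?_
  rw [← lintegral_comp_polarCoord_symm]
  have hc : Measurable fun p : ℝ × ℝ => cylPoint p.1 p.2 z :=
    (continuous_cylPoint.comp (by fun_prop :
      Continuous fun p : ℝ × ℝ => (p.1, p.2, z))).measurable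
  change ∫⁻ p in Set.Ioi 0 ×ˢ Set.Ioo (-Real.pi) Real.pi,
    ENNReal.ofReal p.1 * cylinderExterior.indicator f (cylPoint p.1 p.2 z) = _
  rw [Measure.volume_eq_prod, setLIntegral_prod]
  · have : Set.Ioi (1 : ℝ) = Set.Ioi 0 ∩ Set.Ioi 1 := by
      rw [Set.Ioi_inter_Ioi]; simp
    rw [this, Set.inter_comm, ← Measure.restrict_restrict measurableSet_Ioi,
      ← lintegral_indicator (μ := volume.restrict (Set.Ioi (0:ℝ))) measurableSet_Ioi]
    refine setLIntegral_congr_fun measurableSet_Ioi fun r hr => ?_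
    by_cases h1 : 1 < r
    · rw [Set.indicator_of_mem (show r ∈ Set.Ioi 1 from h1)]
      refine lintegral_congr fun θ => ?_
      rw [Set.indicator_of_mem ((cylPoint_mem_iff hr).2 h1)]
    · rw [Set.indicator_of_notMem (show r ∉ Set.Ioi 1 from h1)]
      refine (lintegral_congr fun θ => ?_).trans lintegral_zero
      rw [Set.indicator_of_notMem (fun h => h1 ((cylPoint_mem_iff hr).1 h)), mul_zero]
  · exact (measurable_fst.ennreal_ofReal.mul (hF.comp hc)).aemeasurable.restrict


/-! ### The half-plane Sobolev inequality for test functions -/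

/-- The pointwise size `∑ᵢ |∂ᵢ φ|` of the gradient. -/
def gradSize (φ : E3 → E3) (x : E3) : ENNReal :=
  ∑ i : Fin 3, ‖fderiv ℝ φ x (EuclideanSpace.single i 1)‖ₑ

theorem continuous_gradSize {φ : E3 → E3} (hφ : ContDiff ℝ ∞ φ) : Continuous (gradSize φ) := by
  have h := hφ.continuous_fderiv (by simp)
  exact continuous_finsetSum _ fun i _ => (h.clm_apply continuous_const).enorm

/-- Expand `v` in the standard basis. Summing the partial derivatives makes the constant 1 for both
the radial and the vertical direction. -/
theorem enorm_fderiv_le_gradSize (φ : E3 → E3) (x v : E3) (hv : ∀ i, |v i| ≤ 1) :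
    ‖fderiv ℝ φ x v‖ₑ ≤ gradSize φ x := by
  have h : v = ∑ i, v i • EuclideanSpace.single i (1 : ℝ) := by
    ext j
    simp [Finset.sum_apply, Pi.single_apply]
  conv_lhs => rw [h]
  rw [map_sum]
  refine (enorm_sum_le _ _).trans (Finset.sum_le_sum fun i _ => ?_)
  rw [map_smul, enorm_smul]
  refine mul_le_of_le_one_left zero_le ?_
  rw [← ofReal_norm, ENNReal.ofReal_le_one]
  exact hv i

theorem hasDerivAt_cylPoint_radius (r θ z : ℝ) :
    HasDerivAt (fun r => cylPoint r θ z) !₂[Real.cos θ, Real.sin θ, 0] r := by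
  have h := ((hasDerivAt_id r).smul_const (!₂[Real.cos θ, Real.sin θ, 0] : E3)).add_const
    (!₂[0, 0, z] : E3)
  rw [one_smul] at h
  refine h.congr_of_eventuallyEq (Filter.Eventually.of_forall fun s => ?_)
  ext i
  fin_cases i <;> simp [cylPoint]

theorem hasDerivAt_cylPoint_height (r θ z : ℝ) :
    HasDerivAt (fun z => cylPoint r θ z) !₂[0, 0, 1] z := by
  have h := ((hasDerivAt_id z).smul_const (!₂[0, 0, 1] : E3)).add_const
    (!₂[r * Real.cos θ, r * Real.sin θ, 0] : E3)
  rw [one_smul] at h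
  refine h.congr_of_eventuallyEq (Filter.Eventually.of_forall fun s => ?_)
  ext i
  fin_cases i <;> simp [cylPoint]

/-- The line version of the truncated Sobolev bound, as a lower integral. -/
theorem ofReal_integral_norm_le_setLIntegral {k : ℝ → ℝ} (hk : Continuous k)
    (h0 : ∀ s, 0 ≤ k s) {a : ℝ} (ha : 0 < a) (hka : ∀ s ≤ a, k s = 0) {φ : E3 → E3}
    (hφ : ContDiff ℝ ∞ φ) {p : ℝ → E3} (hp : ContDiff ℝ 1 p) {v : E3} (hv : ∀ i, |v i| ≤ 1)
    (hpv : ∀ s, HasDerivAt p v s) {c t : ℝ} (hct : c ≤ t) (hc : φ (p c) = 0) :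
    ENNReal.ofReal (∫ s in (0 : ℝ)..‖φ (p t)‖, k s) ≤
      ∫⁻ s in Set.Ioi c, ENNReal.ofReal (k ‖φ (p s)‖) * gradSize φ (p s) := by
  have hγ : ContDiff ℝ 1 (fun s => φ (p s)) := (hφ.of_le (by simp)).comp hp
  have h := integral_norm_le_integral_along_curve hk h0 ha hka hγ hct hc
  have hcont : Continuous fun s => k ‖φ (p s)‖ * ‖deriv (fun s => φ (p s)) s‖ :=
    (hk.comp hγ.continuous.norm).mul (hγ.continuous_deriv le_rfl).norm
  have hnn : ∀ s, 0 ≤ k ‖φ (p s)‖ * ‖deriv (fun s => φ (p s)) s‖ := fun s =>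
    mul_nonneg (h0 _) (norm_nonneg _)
  refine (ENNReal.ofReal_le_ofReal h).trans ?_
  rw [intervalIntegral.integral_of_le hct,
    ofReal_integral_eq_lintegral_ofReal (hcont.integrableOn_Icc.mono_set Set.Ioc_subset_Icc_self)
      (Filter.Eventually.of_forall hnn)]
  refine (lintegral_mono_set Set.Ioc_subset_Ioi_self).trans (lintegral_mono fun s => ?_)
  simp only
  rw [ENNReal.ofReal_mul (h0 _)]
  refine mul_le_mul_right ?_ _
  have hd : deriv (fun s => φ (p s)) s = fderiv ℝ φ (p s) v :=
    (((hφ.differentiable (by simp)) (p s)).hasFDerivAt.comp_hasDerivAt s (hpv s)).deriv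
  rw [hd, ofReal_norm]
  exact enorm_fderiv_le_gradSize φ _ v hv

theorem contDiff_cylPoint_radius (θ z : ℝ) : ContDiff ℝ 1 fun r => cylPoint r θ z := by
  rw [contDiff_euclidean]
  intro i
  fin_cases i <;> simp [cylPoint] <;> fun_prop

theorem contDiff_cylPoint_height (r θ : ℝ) : ContDiff ℝ 1 fun z => cylPoint r θ z := by
  rw [contDiff_euclidean]
  intro i
  fin_cases i <;> simp [cylPoint] <;> fun_prop

/-- Far enough down, a vertical line has left the support; this gives a starting point for
integrating upwards. -/
theorem exists_cylPoint_eq_zero {φ : E3 → E3} (hφ : HasCompactSupport φ) (r θ t : ℝ) :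
    ∃ c ≤ t, φ (cylPoint r θ c) = 0 := by
  obtain ⟨R, hR⟩ := hφ.isCompact.isBounded.subset_closedBall (0 : E3)
  refine ⟨min t (-(|R| + 1)), min_le_left _ _, ?_⟩
  by_contra hne
  have hmem := hR (subset_tsupport φ hne)
  rw [mem_closedBall_zero_iff] at hmem
  have h1 := (PiLp.norm_apply_le (cylPoint r θ (min t (-(|R| + 1)))) 2).trans hmem
  have h2 : cylPoint r θ (min t (-(|R| + 1))) 2 = min t (-(|R| + 1)) := rfl
  rw [h2, Real.norm_eq_abs] at h1
  have h3 := neg_abs_le (min t (-(|R| + 1)))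
  have h4 := min_le_right t (-(|R| + 1))
  linarith [le_abs_self R]

/-- The Sobolev inequality in the half-plane for angular means of truncated test functions. -/
theorem IsTestFunction.lintegral_sq_angular_le {φ : E3 → E3}
    (hφ : IsTestFunction cylinderExterior φ) {k : ℝ → ℝ} (hk : Continuous k)
    (h0 : ∀ s, 0 ≤ k s) {a : ℝ} (ha : 0 < a) (hka : ∀ s ≤ a, k s = 0) :
    ∫⁻ z : ℝ, ∫⁻ r in Set.Ioi (1 : ℝ), ENNReal.ofReal r *
        (∫⁻ θ in Set.Ioo (-Real.pi) Real.pi,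
          ENNReal.ofReal (∫ t in (0 : ℝ)..‖φ (cylPoint r θ z)‖, k t)) ^ 2 ≤
      (∫⁻ x in cylinderExterior, ENNReal.ofReal (k ‖φ x‖) * gradSize φ x) ^ 2 := by
  set f : E3 → ENNReal := fun x => ENNReal.ofReal (k ‖φ x‖) * gradSize φ x with hf
  have hfm : Measurable f :=
    (hk.comp hφ.1.continuous.norm).measurable.ennreal_ofReal.mul
      (continuous_gradSize hφ.1).measurable
  have hm3 : Measurable fun p : ℝ × ℝ × ℝ => ENNReal.ofReal p.1 * f (cylPoint p.1 p.2.1 p.2.2) :=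
    measurable_fst.ennreal_ofReal.mul (hfm.comp continuous_cylPoint.measurable)
  have hm3' : Measurable fun p : ℝ × ℝ × ℝ => f (cylPoint p.1 p.2.1 p.2.2) :=
    hfm.comp continuous_cylPoint.measurable
  set I : Measure ℝ := volume.restrict (Set.Ioo (-Real.pi) Real.pi) with hI
  set J : Measure ℝ := volume.restrict (Set.Ioi (1 : ℝ)) with hJ
  -- Gagliardo's device: with `G` the angular integral, `G ≤ A z` from radial lines and `r G ≤ B r`
  -- from vertical ones. Then `r G² ≤ A z * B r` has separated variables, and `A` and `B` both have
  -- integral `∫ f`.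
  set A : ℝ → ENNReal := fun z => ∫⁻ r, ∫⁻ θ, ENNReal.ofReal r * f (cylPoint r θ z) ∂I ∂J with hA
  set B : ℝ → ENNReal := fun r => ∫⁻ z : ℝ, ∫⁻ θ, ENNReal.ofReal r * f (cylPoint r θ z) ∂I with hB
  have hfint : ∫⁻ x in cylinderExterior, f x = ∫⁻ z, A z := lintegral_cylinderExterior hfm
  have hBint : ∫⁻ r, B r ∂J = ∫⁻ z, A z := by
    refine lintegral_lintegral_swap ?_
    refine Measurable.aemeasurable ?_
    exact Measurable.lintegral_prod_right
      (f := fun (p : ℝ × ℝ) (θ : ℝ) => ENNReal.ofReal p.1 * f (cylPoint p.1 θ p.2))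
      (hm3.comp (by fun_prop : Measurable fun q : (ℝ × ℝ) × ℝ => (q.1.1, q.2, q.1.2)))
  have hvr : ∀ θ : ℝ, ∀ i, |(!₂[Real.cos θ, Real.sin θ, 0] : E3) i| ≤ 1 := by
    intro θ i
    fin_cases i
    · simpa using Real.abs_cos_le_one θ
    · simpa using Real.abs_sin_le_one θ
    · simp
  have hvz : ∀ i, |(!₂[0, 0, 1] : E3) i| ≤ 1 := by
    intro i
    fin_cases i <;> simp
  have hb1 : ∀ θ z : ℝ, φ (cylPoint 1 θ z) = 0 := by
    intro θ z
    by_contra hne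
    exact lt_irrefl _ ((cylPoint_mem_iff one_pos).1 (hφ.2.2 (subset_tsupport φ hne)))
  -- Radial lines start on the cylinder, where `φ` vanishes. Since `r > 1`, the Jacobian weight can
  -- be inserted at no cost; this is where distance from the axis enters.
  have hGA : ∀ z, ∀ r ∈ Set.Ioi (1 : ℝ),
      ∫⁻ θ, ENNReal.ofReal (∫ t in (0 : ℝ)..‖φ (cylPoint r θ z)‖, k t) ∂I ≤ A z := by
    intro z r hr
    have hswap : A z = ∫⁻ θ, ∫⁻ r, ENNReal.ofReal r * f (cylPoint r θ z) ∂J ∂I := by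
      refine lintegral_lintegral_swap (Measurable.aemeasurable ?_)
      exact hm3.comp (by fun_prop : Measurable fun q : ℝ × ℝ => (q.1, q.2, z))
    rw [hswap]
    refine lintegral_mono fun θ => ?_
    refine (ofReal_integral_norm_le_setLIntegral hk h0 ha hka hφ.1
      (contDiff_cylPoint_radius θ z) (hvr θ) (fun s => hasDerivAt_cylPoint_radius s θ z)
      (le_of_lt hr) (hb1 θ z)).trans ?_
    refine setLIntegral_mono' measurableSet_Ioi fun s hs => ?_
    refine le_mul_of_one_le_left zero_le ?_
    rw [← ENNReal.ofReal_one]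
    exact ENNReal.ofReal_le_ofReal (le_of_lt hs)
  -- On a vertical line the weight `r` is constant and passes through the integral.
  have hGB : ∀ z r, ENNReal.ofReal r *
      ∫⁻ θ, ENNReal.ofReal (∫ t in (0 : ℝ)..‖φ (cylPoint r θ z)‖, k t) ∂I ≤ B r := by
    intro z r
    have hswap : B r = ∫⁻ θ, (∫⁻ z, ENNReal.ofReal r * f (cylPoint r θ z)) ∂I := by
      refine lintegral_lintegral_swap (Measurable.aemeasurable ?_)
      exact hm3.comp (by fun_prop : Measurable fun q : ℝ × ℝ => (r, q.2, q.1))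
    rw [hswap, ← lintegral_const_mul' _ _ ENNReal.ofReal_ne_top]
    refine lintegral_mono fun θ => ?_
    simp only
    rw [lintegral_const_mul' _ _ ENNReal.ofReal_ne_top]
    refine mul_le_mul_right ?_ _
    obtain ⟨c, hcz, hc⟩ := exists_cylPoint_eq_zero hφ.2.1 r θ z
    exact (ofReal_integral_norm_le_setLIntegral hk h0 ha hka hφ.1
      (contDiff_cylPoint_height r θ) hvz (fun s => hasDerivAt_cylPoint_height r θ s)
      hcz hc).trans (setLIntegral_le_lintegral _ _)
  have hBm : Measurable B := by
    refine Measurable.lintegral_prod_right (f := fun (r : ℝ) (z : ℝ) =>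
      ∫⁻ θ, ENNReal.ofReal r * f (cylPoint r θ z) ∂I) ?_
    exact Measurable.lintegral_prod_right
      (f := fun (p : ℝ × ℝ) (θ : ℝ) => ENNReal.ofReal p.1 * f (cylPoint p.1 θ p.2))
      (hm3.comp (by fun_prop : Measurable fun q : (ℝ × ℝ) × ℝ => (q.1.1, q.2, q.1.2)))
  calc _ ≤ ∫⁻ z : ℝ, ∫⁻ r, B r * A z ∂J := by
        refine lintegral_mono fun z => setLIntegral_mono' measurableSet_Ioi fun r hr => ?_
        rw [sq, ← mul_assoc]
        exact mul_le_mul' (hGB z r) (hGA z r hr)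
    _ = ∫⁻ z : ℝ, (∫⁻ z, A z) * A z := by
        refine lintegral_congr fun z => ?_
        rw [lintegral_mul_const _ hBm, hBint]
    _ = (∫⁻ z, A z) ^ 2 := by
        rw [lintegral_const_mul, sq]
        refine Measurable.lintegral_prod_right (f := fun (z : ℝ) (r : ℝ) =>
          ∫⁻ θ, ENNReal.ofReal r * f (cylPoint r θ z) ∂I) ?_
        exact Measurable.lintegral_prod_right
          (f := fun (p : ℝ × ℝ) (θ : ℝ) => ENNReal.ofReal p.2 * f (cylPoint p.2 θ p.1))
          (hm3.comp (by fun_prop : Measurable fun q : (ℝ × ℝ) × ℝ => (q.1.2, q.2, q.1.1)))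
    _ = _ := by rw [hfint]

/-! ### Weak derivatives and approximation by test functions -/

theorem integrableOn_smul_of_test {Ω : Set E3} {F : Type*} [NormedAddCommGroup F]
    [NormedSpace ℝ F] {g : E3 → F} (hg : LocallyIntegrableOn g Ω volume) {φ : E3 → ℝ}
    (hφ : Continuous φ) (hφc : HasCompactSupport φ) (hφΩ : tsupport φ ⊆ Ω) :
    Integrable (fun x => φ x • g x) volume := by
  have h1 : IntegrableOn g (tsupport φ) volume :=
    hg.integrableOn_compact_subset hφΩ hφc.isCompact
  have h2 : IntegrableOn (fun x => φ x • g x) (tsupport φ) volume :=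
    h1.continuousOn_smul hφ.continuousOn hφc.isCompact
  rwa [integrableOn_iff_integrable_of_support_subset] at h2
  exact fun x hx => subset_tsupport φ fun h => hx (by simp [h])

/-- The fundamental lemma of the calculus of variations. It makes the arbitrary choice inside
`weakDeriv` harmless. -/
theorem HasWeakDeriv.ae_eq {Ω : Set E3} (hΩ : IsOpen Ω) {i : Fin 3} {u g g' : E3 → E3}
    (h : HasWeakDeriv Ω i u g) (h' : HasWeakDeriv Ω i u g') : g =ᵐ[volume.restrict Ω] g' := by
  have := hΩ.ae_eq_zero_of_integral_contDiff_smul_eq_zero (f := g - g') (μ := volume)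
    (h.2.1.sub h'.2.1) (by
      intro φ hφ hφc hφΩ
      have i1 := integrableOn_smul_of_test h.2.1 hφ.continuous hφc hφΩ
      have i2 := integrableOn_smul_of_test h'.2.1 hφ.continuous hφc hφΩ
      have e1 := h.2.2 φ ⟨hφ, hφc, hφΩ⟩
      have e2 := h'.2.2 φ ⟨hφ, hφc, hφΩ⟩
      have hz : ∀ (f : E3 → E3), ∫ x in Ω, φ x • f x = ∫ x, φ x • f x := fun f =>
        setIntegral_eq_integral_of_forall_compl_eq_zero fun x hx => by
          rw [image_eq_zero_of_notMem_tsupport (fun hh => hx (hφΩ hh)), zero_smul]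
      rw [hz] at e1 e2
      simp only [Pi.sub_apply, smul_sub]
      rw [integral_sub i1 i2, sub_eq_zero]
      exact neg_injective (e1.symm.trans e2))
  filter_upwards [(ae_restrict_iff' hΩ.measurableSet).2 this] with x hx
  exact sub_eq_zero.1 hx

theorem HasWeakDeriv.sub {Ω : Set E3} {i : Fin 3} {u v g g' : E3 → E3}
    (h : HasWeakDeriv Ω i u g) (h' : HasWeakDeriv Ω i v g') :
    HasWeakDeriv Ω i (u - v) (g - g') := by
  refine ⟨h.1.sub h'.1, h.2.1.sub h'.2.1, fun φ hφ => ?_⟩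
  have hd : Continuous (partialDeriv i φ) :=
    (hφ.1.continuous_fderiv (by simp)).clm_apply continuous_const
  have hts : tsupport (partialDeriv i φ) ⊆ tsupport φ := by
    refine closure_minimal (fun x hx => ?_) (isClosed_tsupport _)
    by_contra hn
    refine hx ?_
    simp only [partialDeriv]
    rw [image_eq_zero_of_notMem_tsupport (fun hh => hn (tsupport_fderiv_subset ℝ hh))]
    rfl
  have hdc : HasCompactSupport (partialDeriv i φ) :=
    hφ.2.1.of_isClosed_subset (isClosed_tsupport _) hts
  have i1 := (integrableOn_smul_of_test h.1 hd hdc (hts.trans hφ.2.2)).integrableOn (s := Ω)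
  have i2 := (integrableOn_smul_of_test h'.1 hd hdc (hts.trans hφ.2.2)).integrableOn (s := Ω)
  have i3 := (integrableOn_smul_of_test h.2.1 hφ.1.continuous hφ.2.1 hφ.2.2).integrableOn (s := Ω)
  have i4 := (integrableOn_smul_of_test h'.2.1 hφ.1.continuous hφ.2.1 hφ.2.2).integrableOn
    (s := Ω)
  simp only [Pi.sub_apply, smul_sub]
  rw [integral_sub i1 i2, integral_sub i3 i4, h.2.2 φ hφ, h'.2.2 φ hφ]
  abel

theorem IsTestFunction.hasWeakDeriv {Ω : Set E3} {φ : E3 → E3} (hφ : IsTestFunction Ω φ)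
    (i : Fin 3) :
    HasWeakDeriv Ω i φ fun x => fderiv ℝ φ x (EuclideanSpace.single i 1) := by
  have hc : Continuous fun x => fderiv ℝ φ x (EuclideanSpace.single i 1) :=
    (hφ.1.continuous_fderiv (by simp)).clm_apply continuous_const
  refine ⟨hφ.1.continuous.locallyIntegrable.locallyIntegrableOn _,
    hc.locallyIntegrable.locallyIntegrableOn _, fun ψ hψ => ?_⟩
  have hdψ : Continuous (partialDeriv i ψ) :=
    (hψ.1.continuous_fderiv (by simp)).clm_apply continuous_const
  have hz : ∀ x ∉ Ω, ψ x = 0 := fun x hx =>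
    image_eq_zero_of_notMem_tsupport fun hh => hx (hψ.2.2 hh)
  have hz' : ∀ x ∉ Ω, φ x = 0 := fun x hx =>
    image_eq_zero_of_notMem_tsupport fun hh => hx (hφ.2.2 hh)
  rw [setIntegral_eq_integral_of_forall_compl_eq_zero fun x hx => by rw [hz' x hx, smul_zero],
    setIntegral_eq_integral_of_forall_compl_eq_zero fun x hx => by rw [hz x hx, zero_smul]]
  have h1 : Integrable (fun x => ψ x • fderiv ℝ φ x (EuclideanSpace.single i 1)) :=
    (hψ.1.continuous.smul hc).integrable_of_hasCompactSupport hψ.2.1.smul_right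
  have h2 : Integrable (fun x => partialDeriv i ψ x • φ x) :=
    (hdψ.smul hφ.1.continuous).integrable_of_hasCompactSupport hφ.2.1.smul_left
  have h3 : Integrable (fun x => ψ x • φ x) :=
    (hψ.1.continuous.smul hφ.1.continuous).integrable_of_hasCompactSupport hψ.2.1.smul_right
  have := integral_smul_fderiv_eq_neg_fderiv_smul_of_integrable (𝕜 := ℝ) h2 h1 h3
    (fun x _ => hψ.1.differentiable (by simp) x) (fun x _ => hφ.1.differentiable (by simp) x)
  rw [this, neg_neg]
  rfl

theorem IsTestFunction.memLp {Ω : Set E3} {φ : E3 → E3} (hφ : IsTestFunction Ω φ) :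
    MemLp φ 2 (volume.restrict Ω) :=
  (hφ.1.continuous.memLp_of_hasCompactSupport hφ.2.1).restrict _

theorem IsTestFunction.memLp_fderiv {Ω : Set E3} {φ : E3 → E3} (hφ : IsTestFunction Ω φ)
    (i : Fin 3) :
    MemLp (fun x => fderiv ℝ φ x (EuclideanSpace.single i 1)) 2 (volume.restrict Ω) :=
  (((hφ.1.continuous_fderiv (by simp)).clm_apply continuous_const).memLp_of_hasCompactSupport
    (hφ.2.1.fderiv_apply ℝ _)).restrict _

theorem HasWeakDeriv.weakDeriv_ae_eq {Ω : Set E3} (hΩ : IsOpen Ω) {i : Fin 3} {u g : E3 → E3}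
    (h : HasWeakDeriv Ω i u g) : weakDeriv Ω i u =ᵐ[volume.restrict Ω] g := by
  have hex : ∃ g : E3 → E3, HasWeakDeriv Ω i u g := ⟨g, h⟩
  have : weakDeriv Ω i u = hex.choose := dif_pos hex
  rw [this]
  exact hex.choose_spec.ae_eq hΩ h

theorem MemH1.memLp_weakDeriv {Ω : Set E3} (hΩ : IsOpen Ω) {u : E3 → E3} (hu : MemH1 Ω u)
    (i : Fin 3) : MemLp (weakDeriv Ω i u) 2 (volume.restrict Ω) := by
  obtain ⟨g, hg, hgm⟩ := hu.2 i
  exact hgm.ae_eq (hg.weakDeriv_ae_eq hΩ).symm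

theorem MemH1.weakDeriv_sub_test {Ω : Set E3} (hΩ : IsOpen Ω) {u : E3 → E3} (hu : MemH1 Ω u)
    {φ : E3 → E3} (hφ : IsTestFunction Ω φ) (i : Fin 3) :
    weakDeriv Ω i (u - φ) =ᵐ[volume.restrict Ω]
      weakDeriv Ω i u - fun x => fderiv ℝ φ x (EuclideanSpace.single i 1) := by
  obtain ⟨g, hg, -⟩ := hu.2 i
  filter_upwards [(hg.sub (hφ.hasWeakDeriv i)).weakDeriv_ae_eq hΩ,
    hg.weakDeriv_ae_eq hΩ] with x h1 h2
  rw [h1, Pi.sub_apply, Pi.sub_apply, h2]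

theorem normLp_le_normH1 (Ω : Set E3) (u : E3 → E3) : normLp 2 Ω u ≤ normH1 Ω u := by
  refine Real.le_sqrt_of_sq_le ?_
  exact le_add_of_nonneg_right (Finset.sum_nonneg fun i _ => sq_nonneg _)

theorem normLp_weakDeriv_le_normH1 (Ω : Set E3) (u : E3 → E3) (i : Fin 3) :
    normLp 2 Ω (weakDeriv Ω i u) ≤ normH1 Ω u := by
  refine Real.le_sqrt_of_sq_le ?_
  refine le_add_of_nonneg_of_le (sq_nonneg _) ?_
  exact Finset.single_le_sum (f := fun i => normLp 2 Ω (weakDeriv Ω i u) ^ 2)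
    (fun i _ => sq_nonneg _) (Finset.mem_univ i)

/-- Approximation of an `H¹₀` field by test functions, also almost everywhere. -/
theorem MemH10.exists_seq {Ω : Set E3} (hΩ : IsOpen Ω) {u : E3 → E3} (hu : MemH10 Ω u) :
    ∃ φ : ℕ → E3 → E3, (∀ n, IsTestFunction Ω (φ n)) ∧
      Filter.Tendsto (fun n => eLpNorm (u - φ n) 2 (volume.restrict Ω)) Filter.atTop (nhds 0) ∧
      (∀ i, Filter.Tendsto (fun n => eLpNorm (weakDeriv Ω i u -
        fun x => fderiv ℝ (φ n) x (EuclideanSpace.single i 1)) 2 (volume.restrict Ω))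
        Filter.atTop (nhds 0)) ∧
      ∀ᵐ x ∂(volume.restrict Ω), Filter.Tendsto (fun n => φ n x) Filter.atTop (nhds (u x)) := by
  have h := fun n : ℕ => hu.2 (1 / ((n : ℝ) + 1)) (by positivity)
  choose φ hφ hlt using h
  have hε : Filter.Tendsto (fun n : ℕ => ENNReal.ofReal (1 / ((n : ℝ) + 1))) Filter.atTop
      (nhds 0) := by
    rw [← ENNReal.ofReal_zero]
    exact ENNReal.tendsto_ofReal tendsto_one_div_add_atTop_nhds_zero_nat
  have t1 : Filter.Tendsto (fun n => eLpNorm (u - φ n) 2 (volume.restrict Ω)) Filter.atTop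
      (nhds 0) := by
    refine tendsto_of_tendsto_of_tendsto_of_le_of_le tendsto_const_nhds hε
      (fun _ => zero_le) fun n => ?_
    simp only
    -- A real-valued norm carries no information outside `L²`; membership is needed to turn it back
    -- into `eLpNorm`.
    rw [← ofReal_lpNorm (hu.1.1.sub (hφ n).memLp)]
    exact ENNReal.ofReal_le_ofReal ((normLp_le_normH1 _ _).trans (hlt n).le)
  have t2 : ∀ i, Filter.Tendsto (fun n => eLpNorm (weakDeriv Ω i u -
        fun x => fderiv ℝ (φ n) x (EuclideanSpace.single i 1)) 2 (volume.restrict Ω))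
        Filter.atTop (nhds 0) := by
    intro i
    refine tendsto_of_tendsto_of_tendsto_of_le_of_le tendsto_const_nhds hε
      (fun _ => zero_le) fun n => ?_
    simp only
    have hae := hu.1.weakDeriv_sub_test hΩ (hφ n) i
    rw [← eLpNorm_congr_ae hae, ← ofReal_lpNorm
      (((hu.1.memLp_weakDeriv hΩ i).sub ((hφ n).memLp_fderiv i)).ae_eq hae.symm)]
    exact ENNReal.ofReal_le_ofReal ((normLp_weakDeriv_le_normH1 _ _ i).trans (hlt n).le)
  have hmeas : TendstoInMeasure (volume.restrict Ω) φ Filter.atTop u := by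
    refine tendstoInMeasure_of_tendsto_eLpNorm (p := 2) (by norm_num)
      (fun n => (hφ n).memLp.aestronglyMeasurable) hu.1.1.aestronglyMeasurable ?_
    simpa only [eLpNorm_sub_comm (φ _) u] using t1
  obtain ⟨ns, hns, hae⟩ := hmeas.exists_seq_tendsto_ae
  exact ⟨fun n => φ (ns n), fun n => hφ _, t1.comp hns.tendsto_atTop,
    fun i => (t2 i).comp hns.tendsto_atTop, hae⟩

/-! ### Passage to the limit for axisymmetric fields -/

theorem lintegral_enorm_mul_enorm_le {α F G : Type*} [MeasurableSpace α] {μ : Measure α}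
    [NormedAddCommGroup F] [NormedAddCommGroup G] {f : α → F} {g : α → G}
    (hf : AEStronglyMeasurable f μ) (hg : AEStronglyMeasurable g μ) :
    ∫⁻ x, ‖f x‖ₑ * ‖g x‖ₑ ∂μ ≤ eLpNorm f 2 μ * eLpNorm g 2 μ := by
  have := ENNReal.lintegral_mul_le_Lp_mul_Lq μ Real.HolderConjugate.two_two hf.enorm hg.enorm
  rw [eLpNorm_eq_lintegral_rpow_enorm_toReal (by norm_num) (by norm_num),
    eLpNorm_eq_lintegral_rpow_enorm_toReal (by norm_num) (by norm_num)]
  simpa using this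

/-- Cover the exceptional set by a measurable null set and integrate its indicator in cylindrical
coordinates; the Jacobian is positive, so almost every slice is null. -/
theorem ae_cylPoint_of_ae {P : E3 → Prop}
    (h : ∀ᵐ x ∂(volume.restrict cylinderExterior), P x) :
    ∀ᵐ z : ℝ, ∀ᵐ r ∂(volume.restrict (Set.Ioi (1 : ℝ))),
      ∀ᵐ θ ∂(volume.restrict (Set.Ioo (-Real.pi) Real.pi)), P (cylPoint r θ z) := by
  obtain ⟨s, hs, hsm, hs0⟩ := exists_measurable_superset_of_null (ae_iff.1 h)
  have hm : Measurable (s.indicator (1 : E3 → ENNReal)) := measurable_one.indicator hsm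
  have hint := lintegral_cylinderExterior hm
  rw [lintegral_indicator_one hsm, hs0] at hint
  have hm3 : Measurable fun p : ℝ × ℝ × ℝ =>
      ENNReal.ofReal p.1 * s.indicator (1 : E3 → ENNReal) (cylPoint p.1 p.2.1 p.2.2) :=
    measurable_fst.ennreal_ofReal.mul (hm.comp continuous_cylPoint.measurable)
  have hm2 : Measurable fun p : ℝ × ℝ => ∫⁻ θ in Set.Ioo (-Real.pi) Real.pi,
      ENNReal.ofReal p.2 * s.indicator (1 : E3 → ENNReal) (cylPoint p.2 θ p.1) :=
    Measurable.lintegral_prod_right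
      (f := fun (p : ℝ × ℝ) (θ : ℝ) =>
        ENNReal.ofReal p.2 * s.indicator (1 : E3 → ENNReal) (cylPoint p.2 θ p.1))
      (hm3.comp (by fun_prop : Measurable fun q : (ℝ × ℝ) × ℝ => (q.1.2, q.2, q.1.1)))
  have hm1 : Measurable fun z : ℝ => ∫⁻ r in Set.Ioi (1 : ℝ),
      ∫⁻ θ in Set.Ioo (-Real.pi) Real.pi,
      ENNReal.ofReal r * s.indicator (1 : E3 → ENNReal) (cylPoint r θ z) :=
    Measurable.lintegral_prod_right (f := fun (z : ℝ) (r : ℝ) =>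
      ∫⁻ θ in Set.Ioo (-Real.pi) Real.pi,
        ENNReal.ofReal r * s.indicator (1 : E3 → ENNReal) (cylPoint r θ z)) hm2
  filter_upwards [(lintegral_eq_zero_iff hm1).1 hint.symm] with z hz
  have hz2 := (lintegral_eq_zero_iff (hm2.comp (measurable_const.prodMk measurable_id :
    Measurable fun r : ℝ => (z, r)))).1 hz
  filter_upwards [hz2, ae_restrict_mem measurableSet_Ioi] with r hr hr1
  have hr2 := (lintegral_eq_zero_iff (hm3.comp (by fun_prop :
    Measurable fun θ : ℝ => (r, θ, z)))).1 hr
  filter_upwards [hr2] with θ hθ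
  by_contra hP
  have hmem : cylPoint r θ z ∈ s := hs hP
  have hr0 : (0 : ℝ) < r := lt_trans one_pos hr1
  simp [hmem, hr0.not_ge] at hθ

/-- The cylindrical frame is orthonormal, hence the modulus of an axisymmetric field does not depend
on the angle. -/
theorem norm_axisymmetric_cylPoint {r : ℝ} (hr : 1 < r) (θ z a b c : ℝ) :
    ‖a • eR (cylPoint r θ z) + b • eTheta (cylPoint r θ z) + c • eZ‖ =
      Real.sqrt (a ^ 2 + b ^ 2 + c ^ 2) := by
  have hr0 : r ≠ 0 := by positivity
  have hrad : cylRadius (cylPoint r θ z) = r := by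
    have h : (r * Real.cos θ) ^ 2 + (r * Real.sin θ) ^ 2 = r ^ 2 := by
      rw [mul_pow, mul_pow, ← mul_add, Real.cos_sq_add_sin_sq, mul_one]
    change Real.sqrt ((r * Real.cos θ) ^ 2 + (r * Real.sin θ) ^ 2) = r
    rw [h, Real.sqrt_sq (by linarith)]
  rw [EuclideanSpace.norm_eq]
  congr 1
  simp only [Fin.sum_univ_three, eR, eTheta, eZ, hrad]
  simp [cylPoint, mul_div_cancel_left₀ _ hr0, neg_div]
  nlinarith [Real.sin_sq_add_cos_sq θ]

open Filter Topology in
/-- The truncated `L¹` energies of approximating test functions converge to a limit that is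
controlled by the energy of the limit field. -/
theorem limsup_lintegral_truncation_le {Ω : Set E3} (hΩ : IsOpen Ω) {u : E3 → E3}
    (hu : MemH1 Ω u) {φ : ℕ → E3 → E3} (hφ : ∀ n, IsTestFunction Ω (φ n))
    (h1 : Tendsto (fun n => eLpNorm (u - φ n) 2 (volume.restrict Ω)) atTop (𝓝 0))
    (h2 : ∀ i, Tendsto (fun n => eLpNorm (weakDeriv Ω i u -
        fun x => fderiv ℝ (φ n) x (EuclideanSpace.single i 1)) 2 (volume.restrict Ω))
        atTop (𝓝 0))
    {k : ℝ → ℝ} {K : NNReal} (hk : LipschitzWith K k) (h0 : k 0 = 0) :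
    limsup (fun n => ∫⁻ x in Ω, ENNReal.ofReal (k ‖φ n x‖) * gradSize (φ n) x) atTop ≤
      ∫⁻ x in Ω, ENNReal.ofReal (k ‖u x‖) * ∑ i, ‖weakDeriv Ω i u x‖ₑ := by
  set μ := volume.restrict Ω with hμ
  set R := ∫⁻ x, ENNReal.ofReal (k ‖u x‖) * ∑ i, ‖weakDeriv Ω i u x‖ₑ ∂μ with hR
  set g := fun i => weakDeriv Ω i u with hg
  set dφ : ℕ → Fin 3 → E3 → E3 := fun n i x => fderiv ℝ (φ n) x (EuclideanSpace.single i 1)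
    with hdφ
  have hgm : ∀ i, MemLp (g i) 2 μ := fun i => hu.memLp_weakDeriv hΩ i
  have hum : AEStronglyMeasurable u μ := hu.1.aestronglyMeasurable
  have hφm : ∀ n, AEStronglyMeasurable (φ n) μ := fun n => (hφ n).memLp.aestronglyMeasurable
  have hdm : ∀ n i, AEStronglyMeasurable (g i - dφ n i) μ := fun n i =>
    ((hgm i).sub ((hφ n).memLp_fderiv i)).aestronglyMeasurable
  have hkd : ∀ x y : E3, ENNReal.ofReal (k ‖y‖) ≤ ENNReal.ofReal (k ‖x‖) + K * ‖x - y‖ₑ := by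
    intro x y
    rw [← ofReal_norm, ← ENNReal.ofReal_coe_nnreal, ← ENNReal.ofReal_mul K.coe_nonneg]
    refine (ENNReal.ofReal_le_ofReal ?_).trans ENNReal.ofReal_add_le
    have ha := hk.dist_le_mul ‖y‖ ‖x‖
    rw [Real.dist_eq, Real.dist_eq] at ha
    have hb := (abs_norm_sub_norm_le y x)
    rw [norm_sub_rev] at hb
    have hc := mul_le_mul_of_nonneg_left hb K.coe_nonneg
    linarith [le_abs_self (k ‖y‖ - k ‖x‖)]
  have hk0 : ∀ y : E3, ENNReal.ofReal (k ‖y‖) ≤ K * ‖y‖ₑ := by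
    intro y
    have := hkd 0 y
    simpa [h0] using this
  -- Replacing `k|φ|` by `k|u|` costs `K|u - φ||g|`, and replacing `∂φ` by `g` costs `K|φ||g - ∂φ|`.
  -- Each product pairs a factor tending to zero in `L²` with a bounded one.
  set E : ℕ → ENNReal := fun n => ∑ i, (K * (eLpNorm (u - φ n) 2 μ * eLpNorm (g i) 2 μ) +
    K * (eLpNorm (φ n) 2 μ * eLpNorm (g i - dφ n i) 2 μ)) with hE
  have hbound : ∀ n, ∫⁻ x, ENNReal.ofReal (k ‖φ n x‖) * gradSize (φ n) x ∂μ ≤ R + E n := by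
    intro n
    have hp : ∀ x, ENNReal.ofReal (k ‖φ n x‖) * gradSize (φ n) x ≤
        ENNReal.ofReal (k ‖u x‖) * ∑ i, ‖g i x‖ₑ +
        ∑ i, (K * (‖(u - φ n) x‖ₑ * ‖g i x‖ₑ) + K * (‖φ n x‖ₑ * ‖(g i - dφ n i) x‖ₑ)) := by
      intro x
      rw [Finset.mul_sum, gradSize, Finset.mul_sum, ← Finset.sum_add_distrib]
      refine Finset.sum_le_sum fun i _ => ?_
      have hs : ‖dφ n i x‖ₑ ≤ ‖g i x‖ₑ + ‖(g i - dφ n i) x‖ₑ := by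
        have : dφ n i x = g i x - (g i - dφ n i) x := by simp
        conv_lhs => rw [this]
        exact enorm_sub_le
      calc ENNReal.ofReal (k ‖φ n x‖) * ‖dφ n i x‖ₑ
          ≤ ENNReal.ofReal (k ‖φ n x‖) * (‖g i x‖ₑ + ‖(g i - dφ n i) x‖ₑ) := by gcongr
        _ = ENNReal.ofReal (k ‖φ n x‖) * ‖g i x‖ₑ +
            ENNReal.ofReal (k ‖φ n x‖) * ‖(g i - dφ n i) x‖ₑ := mul_add _ _ _
        _ ≤ (ENNReal.ofReal (k ‖u x‖) + K * ‖(u - φ n) x‖ₑ) * ‖g i x‖ₑ +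
            (K * ‖φ n x‖ₑ) * ‖(g i - dφ n i) x‖ₑ := by
          gcongr
          · exact hkd _ _
          · exact hk0 _
        _ = _ := by ring
    refine (lintegral_mono hp).trans ?_
    have hA : ∀ i, AEMeasurable (fun x => (K : ENNReal) * (‖(u - φ n) x‖ₑ * ‖g i x‖ₑ)) μ :=
      fun i => ((hum.sub (hφm n)).enorm.mul (hgm i).aestronglyMeasurable.enorm).const_mul _
    have hB : ∀ i, AEMeasurable (fun x => (K : ENNReal) * (‖φ n x‖ₑ * ‖(g i - dφ n i) x‖ₑ)) μ :=
      fun i => ((hφm n).enorm.mul (hdm n i).enorm).const_mul _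
    have hAB : ∀ i, AEMeasurable (fun x => (K : ENNReal) * (‖(u - φ n) x‖ₑ * ‖g i x‖ₑ) +
        K * (‖φ n x‖ₑ * ‖(g i - dφ n i) x‖ₑ)) μ := fun i => (hA i).add (hB i)
    rw [lintegral_add_right' _ (Finset.aemeasurable_fun_sum _ fun i _ => hAB i),
      lintegral_finsetSum' _ fun i _ => hAB i]
    refine add_le_add le_rfl (Finset.sum_le_sum fun i _ => ?_)
    rw [lintegral_add_left' (hA i), lintegral_const_mul' _ _ ENNReal.coe_ne_top,
      lintegral_const_mul' _ _ ENNReal.coe_ne_top]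
    gcongr
    · exact lintegral_enorm_mul_enorm_le (hum.sub (hφm n)) (hgm i).aestronglyMeasurable
    · exact lintegral_enorm_mul_enorm_le (hφm n) (hdm n i)
  have hE2 : ∀ n, E n ≤ ∑ i, (K * (eLpNorm (u - φ n) 2 μ * eLpNorm (g i) 2 μ) +
      K * ((eLpNorm u 2 μ + eLpNorm (u - φ n) 2 μ) * eLpNorm (g i - dφ n i) 2 μ)) := by
    intro n
    refine Finset.sum_le_sum fun i _ => ?_
    gcongr
    have : φ n = u - (u - φ n) := by simp
    conv_lhs => rw [this]
    exact eLpNorm_sub_le hum (hum.sub (hφm n)) (by norm_num)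
  have hlim : Tendsto (fun n => R + ∑ i, (K * (eLpNorm (u - φ n) 2 μ * eLpNorm (g i) 2 μ) +
      K * ((eLpNorm u 2 μ + eLpNorm (u - φ n) 2 μ) * eLpNorm (g i - dφ n i) 2 μ)))
      atTop (𝓝 (R + ∑ i : Fin 3, (K * (0 * eLpNorm (g i) 2 μ) +
        K * ((eLpNorm u 2 μ + 0) * 0)))) := by
    refine tendsto_const_nhds.add (tendsto_finsetSum _ fun i _ => ?_)
    refine Tendsto.add ?_ ?_
    · refine ENNReal.Tendsto.const_mul ?_ (Or.inr ENNReal.coe_ne_top)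
      exact ENNReal.Tendsto.mul_const h1 (Or.inr (hgm i).eLpNorm_ne_top)
    · refine ENNReal.Tendsto.const_mul ?_ (Or.inr ENNReal.coe_ne_top)
      refine ENNReal.Tendsto.mul (tendsto_const_nhds.add h1) (Or.inr ENNReal.zero_ne_top) (h2 i)
        (Or.inr ?_)
      rw [add_zero]
      exact hu.1.eLpNorm_ne_top
  simp only [zero_mul, mul_zero, add_zero, Finset.sum_const_zero] at hlim
  refine le_trans (limsup_le_limsup (Eventually.of_forall fun n => ?_)) hlim.limsup_eq.le
  exact (hbound n).trans (add_le_add le_rfl (hE2 n))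

-- For a function constant in the angle, the integral of the square is `W² ν` and the square of the
-- integral is `W² ν²`, so a total mass at least 1 reverses Jensen. Fatou handles the limit. This is
-- how axisymmetry removes the angular average.
open Filter Topology in
theorem lintegral_sq_le_liminf_sq_lintegral {α : Type*} [MeasurableSpace α] {ν : Measure α}
    (hν : 1 ≤ ν Set.univ) {c : ENNReal} (hc : c ≠ ⊤) {w : α → ENNReal} {W : ENNReal}
    {v : ℕ → α → ENNReal} (hv : ∀ n, Measurable (v n)) (hconst : ∀ᵐ θ ∂ν, w θ = W)
    (hconv : ∀ᵐ θ ∂ν, W ≤ liminf (fun n => v n θ) atTop) :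
    ∫⁻ θ, c * w θ ^ 2 ∂ν ≤ liminf (fun n => c * (∫⁻ θ, v n θ ∂ν) ^ 2) atTop := by
  have hWG : W * ν Set.univ ≤ liminf (fun n => ∫⁻ θ, v n θ ∂ν) atTop := by
    rw [← lintegral_const]
    exact (lintegral_mono_ae hconv).trans (lintegral_liminf_le hv)
  have hmap : c * (liminf (fun n => ∫⁻ θ, v n θ ∂ν) atTop) ^ 2 =
      liminf (fun n => c * (∫⁻ θ, v n θ ∂ν) ^ 2) atTop := by
    refine Monotone.map_liminf_of_continuousAt (f := fun y : ENNReal => c * y ^ 2) ?_ _ ?_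
    · exact fun x y hxy => mul_le_mul_right (pow_le_pow_left' hxy 2) _
    · exact ((ENNReal.continuous_const_mul hc).comp (ENNReal.continuous_pow 2)).continuousAt
  rw [← hmap, lintegral_const_mul' _ _ hc]
  refine mul_le_mul_right ?_ _
  refine le_trans ?_ (pow_le_pow_left' hWG 2)
  rw [lintegral_congr_ae (hconst.mono fun θ hθ => by simp only [hθ] :
    (fun θ => w θ ^ 2) =ᵐ[ν] fun _ => W ^ 2), lintegral_const, mul_pow]
  refine mul_le_mul_right ?_ _
  rw [sq (ν _)]
  exact le_mul_of_one_le_left zero_le hν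

open Filter Topology in
/-- The truncation inequality for the modulus of an axisymmetric `H¹₀` field. -/
theorem MemH10.truncationInequality {u : E3 → E3} (hu : MemH10 cylinderExterior u)
    (hax : IsAxisymmetric cylinderExterior u) {U : E3 → ℝ} (hU : Measurable U)
    (hUu : U =ᵐ[volume.restrict cylinderExterior] fun x => ‖u x‖) :
    TruncationInequality (volume.restrict cylinderExterior) U
      fun x => ∑ i, ‖weakDeriv cylinderExterior i u x‖ₑ := by
  intro k K a ha hkL hk0 hka
  obtain ⟨φ, hφ, h1, h2, h3⟩ := hu.exists_seq isOpen_cylinderExterior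
  obtain ⟨ur, uθ, uz, hax⟩ := hax
  have hkc := hkL.continuous
  set h : ℝ → ℝ := fun y => ∫ t in (0 : ℝ)..y, k t with hh
  have hhc : Continuous h :=
    intervalIntegral.continuous_primitive (fun _ _ => hkc.intervalIntegrable _ _) 0
  set I : Measure ℝ := volume.restrict (Set.Ioo (-Real.pi) Real.pi) with hI
  set J : Measure ℝ := volume.restrict (Set.Ioi (1 : ℝ)) with hJ
  have hI1 : 1 ≤ I Set.univ := by
    rw [hI, Measure.restrict_apply_univ, Real.volume_Ioo, ← ENNReal.ofReal_one]
    exact ENNReal.ofReal_le_ofReal (by linarith [Real.pi_gt_three])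
  set w : E3 → ENNReal := fun x => ENNReal.ofReal (h (U x)) with hw
  have hwm : Measurable w := (hhc.measurable.comp hU).ennreal_ofReal
  set G : ℕ → ℝ → ℝ → ENNReal := fun n z r =>
    ∫⁻ θ, ENNReal.ofReal (h ‖φ n (cylPoint r θ z)‖) ∂I with hG
  have hvm : ∀ n, Measurable fun x => ENNReal.ofReal (h ‖φ n x‖) := fun n =>
    (hhc.comp (hφ n).1.continuous.norm).measurable.ennreal_ofReal
  have hv3 : ∀ n, Measurable fun q : (ℝ × ℝ) × ℝ =>
      ENNReal.ofReal (h ‖φ n (cylPoint q.1.2 q.2 q.1.1)‖) := fun n =>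
    (hvm n).comp (continuous_cylPoint.measurable.comp
      (by fun_prop : Measurable fun q : (ℝ × ℝ) × ℝ => (q.1.2, q.2, q.1.1)))
  have hGm : ∀ n, Measurable fun p : ℝ × ℝ => G n p.1 p.2 := fun n =>
    Measurable.lintegral_prod_right (f := fun (p : ℝ × ℝ) (θ : ℝ) =>
      ENNReal.ofReal (h ‖φ n (cylPoint p.2 θ p.1)‖)) (hv3 n)
  have hFm : ∀ n, Measurable fun p : ℝ × ℝ => ENNReal.ofReal p.2 * G n p.1 p.2 ^ 2 := fun n =>
    measurable_snd.ennreal_ofReal.mul ((hGm n).pow_const 2)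
  have hpt : ∀ᵐ z : ℝ, ∀ᵐ r ∂J, ∫⁻ θ, ENNReal.ofReal r * w (cylPoint r θ z) ^ 2 ∂I ≤
      liminf (fun n => ENNReal.ofReal r * G n z r ^ 2) atTop := by
    -- On almost every circle the approximants converge and `U` equals the angle-independent modulus
    -- `√(ur² + uθ² + uz²)`.
    filter_upwards [ae_cylPoint_of_ae (h3.and (hUu.and hax))] with z hz
    filter_upwards [hz, ae_restrict_mem measurableSet_Ioi] with r hr hr1
    set W : ENNReal := ENNReal.ofReal
      (h (Real.sqrt (ur r z ^ 2 + uθ r z ^ 2 + uz r z ^ 2))) with hW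
    have hrad : ∀ θ, cylRadius (cylPoint r θ z) = r := by
      intro θ
      have h : (r * Real.cos θ) ^ 2 + (r * Real.sin θ) ^ 2 = r ^ 2 := by
        rw [mul_pow, mul_pow, ← mul_add, Real.cos_sq_add_sin_sq, mul_one]
      change Real.sqrt ((r * Real.cos θ) ^ 2 + (r * Real.sin θ) ^ 2) = r
      rw [h, Real.sqrt_sq (by linarith [show (1 : ℝ) < r from hr1])]
    have hconst : ∀ᵐ θ ∂I, w (cylPoint r θ z) = W := by
      filter_upwards [hr] with θ hθ
      have e : U (cylPoint r θ z) = Real.sqrt (ur r z ^ 2 + uθ r z ^ 2 + uz r z ^ 2) := by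
        rw [hθ.2.1, hθ.2.2, hrad θ]
        exact norm_axisymmetric_cylPoint hr1 θ z _ _ _
      simp only [hw, hW, e]
    have hconv : ∀ᵐ θ ∂I, W ≤
        liminf (fun n => ENNReal.ofReal (h ‖φ n (cylPoint r θ z)‖)) atTop := by
      filter_upwards [hr, hconst] with θ hθ hθc
      have ht : Tendsto (fun n => ENNReal.ofReal (h ‖φ n (cylPoint r θ z)‖)) atTop
          (𝓝 (ENNReal.ofReal (h ‖u (cylPoint r θ z)‖))) :=
        ENNReal.tendsto_ofReal ((hhc.tendsto _).comp hθ.1.norm)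
      rw [ht.liminf_eq, ← hθc]
      simp only [hw, hθ.2.1]
      exact le_rfl
    exact lintegral_sq_le_liminf_sq_lintegral hI1 ENNReal.ofReal_ne_top (fun n => (hvm n).comp
      (continuous_cylPoint.comp (by fun_prop : Continuous fun θ : ℝ => (r, θ, z))).measurable)
      hconst hconv
  calc ∫⁻ x in cylinderExterior, ENNReal.ofReal (h (U x)) ^ 2
      = ∫⁻ z : ℝ, ∫⁻ r, ∫⁻ θ, ENNReal.ofReal r * w (cylPoint r θ z) ^ 2 ∂I ∂J :=
        lintegral_cylinderExterior (hwm.pow_const 2)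
    _ ≤ ∫⁻ z : ℝ, ∫⁻ r, liminf (fun n => ENNReal.ofReal r * G n z r ^ 2) atTop ∂J := by
        refine lintegral_mono_ae ?_
        filter_upwards [hpt] with z hz using lintegral_mono_ae hz
    _ ≤ ∫⁻ z : ℝ, liminf (fun n => ∫⁻ r, ENNReal.ofReal r * G n z r ^ 2 ∂J) atTop := by
        refine lintegral_mono fun z => lintegral_liminf_le fun n => ?_
        exact (hFm n).comp (measurable_const.prodMk measurable_id :
          Measurable fun r : ℝ => (z, r))
    _ ≤ liminf (fun n => ∫⁻ z : ℝ, ∫⁻ r, ENNReal.ofReal r * G n z r ^ 2 ∂J) atTop := by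
        refine lintegral_liminf_le fun n => ?_
        exact Measurable.lintegral_prod_right
          (f := fun (z : ℝ) (r : ℝ) => ENNReal.ofReal r * G n z r ^ 2) (hFm n)
    _ ≤ limsup (fun n => (∫⁻ x in cylinderExterior,
          ENNReal.ofReal (k ‖φ n x‖) * gradSize (φ n) x) ^ 2) atTop := by
        refine le_trans (liminf_le_limsup) (limsup_le_limsup (Eventually.of_forall fun n => ?_))
        exact (hφ n).lintegral_sq_angular_le hkc hk0 ha hka
    _ = (limsup (fun n => ∫⁻ x in cylinderExterior,
          ENNReal.ofReal (k ‖φ n x‖) * gradSize (φ n) x) atTop) ^ 2 := by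
        refine (Monotone.map_limsup_of_continuousAt (f := fun y : ENNReal => y ^ 2) ?_ _ ?_).symm
        · exact fun x y hxy => pow_le_pow_left' hxy 2
        · exact (ENNReal.continuous_pow 2).continuousAt
    _ ≤ (∫⁻ x in cylinderExterior, ENNReal.ofReal (k ‖u x‖) *
          ∑ i, ‖weakDeriv cylinderExterior i u x‖ₑ) ^ 2 :=
        pow_le_pow_left' (limsup_lintegral_truncation_le isOpen_cylinderExterior hu.1 hφ h1 h2
          hkL (hka 0 ha.le)) 2
    _ = _ := by
        congr 1
        refine lintegral_congr_ae ?_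
        filter_upwards [hUu] with x hx
        rw [hx]

/-! ### Choice of the level and the weighted splitting -/

theorem lintegral_enorm_pow_eq {α F : Type*} [MeasurableSpace α] {μ : Measure α}
    [NormedAddCommGroup F] (f : α → F) {n : ℕ} (hn : n ≠ 0) :
    ∫⁻ x, ‖f x‖ₑ ^ n ∂μ = eLpNorm f n μ ^ n := by
  have hn' : (n : ℝ) ≠ 0 := by exact_mod_cast hn
  rw [eLpNorm_eq_lintegral_rpow_enorm_toReal (by exact_mod_cast hn) (ENNReal.natCast_ne_top n),
    ENNReal.toReal_natCast, ← ENNReal.rpow_natCast, ← ENNReal.rpow_mul, one_div,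
    inv_mul_cancel₀ hn', ENNReal.rpow_one]
  simp only [ENNReal.rpow_natCast]

theorem lintegral_enorm_sq_eq {α F : Type*} [MeasurableSpace α] {μ : Measure α}
    [NormedAddCommGroup F] {f : α → F} (hf : MemLp f 2 μ) :
    ∫⁻ x, ‖f x‖ₑ ^ 2 ∂μ = ENNReal.ofReal (lpNorm f 2 μ ^ 2) := by
  rw [lintegral_enorm_pow_eq f two_ne_zero, ENNReal.ofReal_pow lpNorm_nonneg, ofReal_lpNorm hf]
  norm_num

theorem sq_sum_enorm_le {F : Type*} [NormedAddCommGroup F] (v : Fin 3 → F) :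
    (∑ i, ‖v i‖ₑ) ^ 2 ≤ 3 * ∑ i, ‖v i‖ₑ ^ 2 := by
  have h := sq_sum_le_card_mul_sum_sq (s := Finset.univ) (f := fun i => ‖v i‖)
  simp only [Finset.card_univ, Fintype.card_fin, Nat.cast_ofNat] at h
  simp only [← ofReal_norm]
  rw [← ENNReal.ofReal_sum_of_nonneg fun i _ => norm_nonneg _,
    ← ENNReal.ofReal_pow (Finset.sum_nonneg fun i _ => norm_nonneg _)]
  refine (ENNReal.ofReal_le_ofReal h).trans (le_of_eq ?_)
  rw [ENNReal.ofReal_mul (by norm_num), ENNReal.ofReal_sum_of_nonneg fun i _ => sq_nonneg _]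
  simp [ENNReal.ofReal_pow]

theorem MemH1.lintegral_sq_grad_le {Ω : Set E3} (hΩ : IsOpen Ω) {u : E3 → E3}
    (hu : MemH1 Ω u) :
    ∫⁻ x in Ω, (∑ i, ‖weakDeriv Ω i u x‖ₑ) ^ 2 ≤ ENNReal.ofReal (3 * normH1 Ω u ^ 2) := by
  have hm := fun i => hu.memLp_weakDeriv hΩ i
  calc ∫⁻ x in Ω, (∑ i, ‖weakDeriv Ω i u x‖ₑ) ^ 2
      ≤ ∫⁻ x in Ω, 3 * ∑ i, ‖weakDeriv Ω i u x‖ₑ ^ 2 :=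
        lintegral_mono fun x => sq_sum_enorm_le _
    _ = 3 * ∑ i, ENNReal.ofReal (normLp 2 Ω (weakDeriv Ω i u) ^ 2) := by
        rw [lintegral_const_mul' _ _ (by norm_num), lintegral_finsetSum' _
          fun i _ => (hm i).aestronglyMeasurable.enorm.pow_const 2]
        simp only [lintegral_enorm_sq_eq (hm _), normLp]
    _ = ENNReal.ofReal (3 * ∑ i, normLp 2 Ω (weakDeriv Ω i u) ^ 2) := by
        rw [ENNReal.ofReal_mul (by norm_num), ENNReal.ofReal_sum_of_nonneg fun i _ => sq_nonneg _]
        simp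
    _ ≤ _ := by
        refine ENNReal.ofReal_le_ofReal ?_
        have : 0 ≤ ∑ i, normLp 2 Ω (weakDeriv Ω i u) ^ 2 :=
          Finset.sum_nonneg fun i _ => sq_nonneg _
        rw [normH1, Real.sq_sqrt (by positivity)]
        linarith [sq_nonneg (normLp 2 Ω u)]

/-- At the level `M ~ H √(ln (2 + H²))` the fourth moment of the excess is at most `3 H²`. -/
theorem TruncationInequality.exists_level {α : Type*} [MeasurableSpace α] {μ : Measure α}
    {U : α → ℝ} {Γ : α → ENNReal} (h : TruncationInequality μ U Γ) (hU : Measurable U)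
    (hΓ : AEMeasurable Γ μ) {H : ℝ} (hH : 0 < H)
    (hB : ∫⁻ x, ENNReal.ofReal (U x) ^ 2 ∂μ ≤ ENNReal.ofReal (H ^ 2))
    (hD : ∫⁻ x, Γ x ^ 2 ∂μ ≤ ENNReal.ofReal (3 * H ^ 2)) :
    ∃ M : ℝ, 0 < M ∧ M ^ 2 ≤ 1728 * Real.log (2 + H ^ 2) * H ^ 2 ∧
      ∫⁻ x, ENNReal.ofReal (U x - M) ^ 4 ∂μ ≤ ENNReal.ofReal (3 * H ^ 2) := by
  set L := Real.log (2 + H ^ 2) with hL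
  -- This lower bound absorbs the rounding in `n = ⌈L⌉₊`: `n < L + 1 ≤ 3 L`.
  have hL2 : 1 / 2 ≤ L := by
    have h1 : Real.log 2 ≤ L := Real.log_le_log (by norm_num) (by linarith [sq_nonneg H])
    linarith [Real.log_two_gt_d9]
  set n := ⌈L⌉₊ with hn
  have hnL : L ≤ n := Nat.le_ceil L
  have hn1 : 1 ≤ n := Nat.one_le_ceil_iff.2 (by linarith)
  have hn1' : (1 : ℝ) ≤ n := by exact_mod_cast hn1
  have hn3 : (n : ℝ) ≤ 3 * L := by
    have := Nat.ceil_lt_add_one (show 0 ≤ L by linarith)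
    linarith
  set e := Real.exp 1 with he
  have he0 : 0 < e := Real.exp_pos 1
  have he1 : 1 ≤ e := Real.one_le_exp zero_le_one
  have he3 : e ≤ 3 := by linarith [Real.exp_one_lt_d9]
  -- Chosen so that the base `64 n (3 H²) / M²` of the tail bound is exactly `e⁻¹`; then `n ≥ L`
  -- gives `e⁻ⁿ ≤ 1 / (2 + H²)`. With `e n ≤ 9 L`, the constant 1728 is `192 * 9`.
  set M := Real.sqrt (192 * e * n * H ^ 2) with hM
  have hM2 : M ^ 2 = 192 * e * n * H ^ 2 := Real.sq_sqrt (by positivity)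
  have hM0 : 0 < M := Real.sqrt_pos.2 (by positivity)
  refine ⟨M, hM0, ?_, ?_⟩
  · rw [hM2]
    have : e * n ≤ 3 * (3 * L) := mul_le_mul he3 hn3 (by linarith) (by norm_num)
    have := mul_le_mul_of_nonneg_right this (sq_nonneg H)
    nlinarith
  refine (h.fourth_moment_le hU hΓ hB hD hM0).trans ?_
  refine (mul_le_mul_right (h.measure_tail hU hΓ (sq_nonneg H) (by positivity) hB hD hn1 hM0)
    _).trans ?_
  rw [← ENNReal.ofReal_pow (by positivity), ← ENNReal.ofReal_ofNat 16,
    ← ENNReal.ofReal_mul (by norm_num), ← ENNReal.ofReal_mul (by positivity)]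
  refine ENNReal.ofReal_le_ofReal ?_
  have hq : 64 * n * (3 * H ^ 2) / M ^ 2 = e⁻¹ := by
    rw [hM2]; field_simp; norm_num
  have hen : (e⁻¹) ^ n ≤ 1 / (2 + H ^ 2) := by
    rw [inv_pow, he, ← Real.exp_nat_mul, mul_one, one_div]
    refine inv_anti₀ (by positivity) ?_
    rw [← Real.exp_log (show 0 < 2 + H ^ 2 by positivity)]
    exact Real.exp_le_exp.2 hnL
  rw [hq]
  -- The prefactor is of order `H⁴`; the gain `1 / (2 + H²)` brings it down to `H²`.
  calc 16 * (3 * H ^ 2) ^ 2 * (4 * H ^ 2 / M ^ 2 * (e⁻¹) ^ n)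
      ≤ 16 * (3 * H ^ 2) ^ 2 * (4 * H ^ 2 / M ^ 2 * (1 / (2 + H ^ 2))) := by gcongr
    _ = 3 * H ^ 2 * (H ^ 2 / (2 + H ^ 2)) / (e * n) := by
        rw [hM2]; field_simp; ring
    _ ≤ 3 * H ^ 2 * 1 / 1 := by
        gcongr
        · rw [div_le_one (by positivity)]; linarith
        · nlinarith
    _ = 3 * H ^ 2 := by ring

/-- Split at `‖v‖ = 2M`, not at `M`: above that value `‖v‖ ≤ 2 (‖v‖ - M)`, so the excess controls
the whole vector; below it, one factor `ρ ‖v‖²` is at most `4 ρbar M²` and the other keeps its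
weight. -/
theorem enorm_sqrt_smul_pow_four_le {F : Type*} [NormedAddCommGroup F] [NormedSpace ℝ F]
    {ρ ρbar : ℝ} (h0 : 0 ≤ ρ) (h1 : ρ ≤ ρbar) (v : F) {M : ℝ} (hM : 0 < M) :
    ‖Real.sqrt ρ • v‖ₑ ^ 4 ≤ ENNReal.ofReal (4 * ρbar * M ^ 2) * ‖Real.sqrt ρ • v‖ₑ ^ 2 +
      ENNReal.ofReal (16 * ρbar ^ 2) * ENNReal.ofReal (‖v‖ - M) ^ 4 := by
  have hρ : 0 ≤ ρbar := h0.trans h1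
  have hnorm : ‖Real.sqrt ρ • v‖ ^ 2 = ρ * ‖v‖ ^ 2 := by
    rw [norm_smul, mul_pow, Real.norm_eq_abs, sq_abs, Real.sq_sqrt h0]
  rcases le_total ‖v‖ (2 * M) with hv | hv
  · refine le_trans ?_ (le_add_of_nonneg_right zero_le)
    rw [← ofReal_norm, ← ENNReal.ofReal_pow (norm_nonneg _), ← ENNReal.ofReal_pow (norm_nonneg _),
      ← ENNReal.ofReal_mul (by positivity)]
    refine ENNReal.ofReal_le_ofReal ?_
    have hs : ‖Real.sqrt ρ • v‖ ^ 2 ≤ 4 * ρbar * M ^ 2 := by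
      rw [hnorm]
      calc ρ * ‖v‖ ^ 2 ≤ ρbar * (2 * M) ^ 2 := by gcongr
        _ = _ := by ring
    calc ‖Real.sqrt ρ • v‖ ^ 4 = ‖Real.sqrt ρ • v‖ ^ 2 * ‖Real.sqrt ρ • v‖ ^ 2 := by ring
      _ ≤ _ := mul_le_mul_of_nonneg_right hs (sq_nonneg _)
  · refine le_trans ?_ (le_add_of_nonneg_left zero_le)
    have hvM : 0 ≤ ‖v‖ - M := by linarith
    rw [← ofReal_norm, ← ENNReal.ofReal_pow (norm_nonneg _), ← ENNReal.ofReal_pow hvM,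
      ← ENNReal.ofReal_mul (by positivity)]
    refine ENNReal.ofReal_le_ofReal ?_
    calc ‖Real.sqrt ρ • v‖ ^ 4 = (‖Real.sqrt ρ • v‖ ^ 2) ^ 2 := by ring
      _ = (ρ * ‖v‖ ^ 2) ^ 2 := by rw [hnorm]
      _ ≤ (ρbar * (2 * (‖v‖ - M)) ^ 2) ^ 2 := by gcongr; linarith
      _ = _ := by ring

end

/-! ### The weighted estimate -/

theorem lemma2p6 (ρbar : ℝ) (hρbar : 0 ≤ ρbar) :
    ∃ C : ℝ, 0 < C ∧
      ∀ (ρ : E3 → ℝ) (u : E3 → E3),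
        AEMeasurable ρ (volume.restrict cylinderExterior) →
        (∀ᵐ x ∂(volume.restrict cylinderExterior), 0 ≤ ρ x ∧ ρ x ≤ ρbar) →
        MemH10 cylinderExterior u →
        IsAxisymmetric cylinderExterior u →
        MemLp (fun x => Real.sqrt (ρ x) • u x) 4 (volume.restrict cylinderExterior) ∧
        normLp 4 cylinderExterior (fun x => Real.sqrt (ρ x) • u x) ^ 2 ≤
          C * (1 + normLp 2 cylinderExterior (fun x => Real.sqrt (ρ x) • u x)) *
            normH1 cylinderExterior u *
            Real.sqrt (Real.log (2 + normH1 cylinderExterior u ^ 2)) := by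
  -- Here `6912 = 4 * 1728` comes from the part below `2M`, and `96 = 16 * 3 * 2` from the excess,
  -- using `H² ≤ 2 H² L`. The summand 1 keeps the constant positive when `ρbar = 0`.
  set C₀ : ℝ := 6912 * ρbar + 96 * ρbar ^ 2 + 1 with hC₀
  have hC₀pos : 0 < C₀ := by positivity
  refine ⟨Real.sqrt C₀, Real.sqrt_pos.2 hC₀pos, fun ρ u hρm hρ hu hax => ?_⟩
  set μ := volume.restrict cylinderExterior with hμ
  set f : E3 → E3 := fun x => Real.sqrt (ρ x) • u x with hf
  set H := normH1 cylinderExterior u with hH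
  set A := normLp 2 cylinderExterior f with hA
  set L := Real.log (2 + H ^ 2) with hL
  have hH0 : 0 ≤ H := Real.sqrt_nonneg _
  have hA0 : 0 ≤ A := lpNorm_nonneg
  have hL2 : 1 / 2 ≤ L := by
    have h1 : Real.log 2 ≤ L := Real.log_le_log (by norm_num) (by linarith [sq_nonneg H])
    linarith [Real.log_two_gt_d9]
  have hfm : AEStronglyMeasurable f μ :=
    (Real.continuous_sqrt.measurable.comp_aemeasurable hρm).aestronglyMeasurable.smul
      hu.1.1.aestronglyMeasurable
  have huH : normLp 2 cylinderExterior u ≤ H := normLp_le_normH1 _ _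
  -- For `H = 0` the level `M` would degenerate to zero, but then `u` vanishes almost everywhere.
  rcases hH0.eq_or_lt with hHz | hHpos
  · have hu0 : u =ᵐ[μ] 0 :=
      (lpNorm_eq_zero hu.1.1 two_ne_zero).1 (le_antisymm (huH.trans hHz.symm.le) lpNorm_nonneg)
    have hf0 : f =ᵐ[μ] 0 := by
      filter_upwards [hu0] with x hx
      simp only [hf, hx, Pi.zero_apply, smul_zero]
    have hfL : MemLp f 4 μ := (memLp_congr_ae hf0).2 MemLp.zero
    refine ⟨hfL, ?_⟩
    have : normLp 4 cylinderExterior f = 0 := (lpNorm_eq_zero hfL (by norm_num)).2 hf0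
    rw [this, ← hHz]
    simp
  have hf2 : MemLp f 2 μ := by
    refine hu.1.1.of_le_mul (c := Real.sqrt ρbar) hfm ?_
    filter_upwards [hρ] with x hx
    rw [hf, norm_smul, Real.norm_of_nonneg (Real.sqrt_nonneg _)]
    gcongr
    exact hx.2
  -- A Borel representative of `|u|`: its superlevel sets and its integrals in cylindrical
  -- coordinates require genuine measurability.
  obtain ⟨U, hU, hUu⟩ := hu.1.1.aestronglyMeasurable.norm.aemeasurable
  have htrunc := hu.truncationInequality hax hU hUu.symm
  have hΓm : AEMeasurable (fun x => ∑ i, ‖weakDeriv cylinderExterior i u x‖ₑ) μ :=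
    Finset.aemeasurable_fun_sum _ fun i _ =>
      (hu.1.memLp_weakDeriv isOpen_cylinderExterior i).aestronglyMeasurable.enorm
  have hB : ∫⁻ x, ENNReal.ofReal (U x) ^ 2 ∂μ ≤ ENNReal.ofReal (H ^ 2) := by
    have : ∫⁻ x, ENNReal.ofReal (U x) ^ 2 ∂μ = ∫⁻ x, ‖u x‖ₑ ^ 2 ∂μ := by
      refine lintegral_congr_ae ?_
      filter_upwards [hUu] with x hx
      rw [← hx, ofReal_norm]
    rw [this, lintegral_enorm_sq_eq hu.1.1]
    exact ENNReal.ofReal_le_ofReal (pow_le_pow_left₀ lpNorm_nonneg huH 2)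
  obtain ⟨M, hM, hM2, hX⟩ := htrunc.exists_level hU hΓm hHpos hB
    (hu.1.lintegral_sq_grad_le isOpen_cylinderExterior)
  have h4 : ∫⁻ x, ‖f x‖ₑ ^ 4 ∂μ ≤ ENNReal.ofReal (C₀ * (1 + A) ^ 2 * H ^ 2 * L) := by
    calc ∫⁻ x, ‖f x‖ₑ ^ 4 ∂μ
        ≤ ∫⁻ x, (ENNReal.ofReal (4 * ρbar * M ^ 2) * ‖f x‖ₑ ^ 2 +
            ENNReal.ofReal (16 * ρbar ^ 2) * ENNReal.ofReal (U x - M) ^ 4) ∂μ := by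
          refine lintegral_mono_ae ?_
          filter_upwards [hρ, hUu] with x hx hUx
          rw [← hUx]
          exact enorm_sqrt_smul_pow_four_le hx.1 hx.2 (u x) hM
      _ = ENNReal.ofReal (4 * ρbar * M ^ 2) * ENNReal.ofReal (A ^ 2) +
            ENNReal.ofReal (16 * ρbar ^ 2) * ∫⁻ x, ENNReal.ofReal (U x - M) ^ 4 ∂μ := by
          rw [lintegral_add_left' ((hfm.enorm.pow_const 2).const_mul _),
            lintegral_const_mul' _ _ ENNReal.ofReal_ne_top,
            lintegral_const_mul' _ _ ENNReal.ofReal_ne_top, lintegral_enorm_sq_eq hf2]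
          rfl
      _ ≤ ENNReal.ofReal (4 * ρbar * M ^ 2) * ENNReal.ofReal (A ^ 2) +
            ENNReal.ofReal (16 * ρbar ^ 2) * ENNReal.ofReal (3 * H ^ 2) := by gcongr
      _ = ENNReal.ofReal (4 * ρbar * M ^ 2 * A ^ 2 + 16 * ρbar ^ 2 * (3 * H ^ 2)) := by
          rw [ENNReal.ofReal_add (by positivity) (by positivity),
            ← ENNReal.ofReal_mul (by positivity), ← ENNReal.ofReal_mul (by positivity)]
      _ ≤ _ := by
          refine ENNReal.ofReal_le_ofReal ?_
          have hL0 : 0 ≤ L := by linarith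
          have hHL : H ^ 2 ≤ 2 * (H ^ 2 * L) := by nlinarith [sq_nonneg H]
          have hHL0 : 0 ≤ H ^ 2 * L := by positivity
          have hA1 : A ^ 2 ≤ (1 + A) ^ 2 := by nlinarith
          have hA2 : 1 ≤ (1 + A) ^ 2 := by nlinarith
          calc 4 * ρbar * M ^ 2 * A ^ 2 + 16 * ρbar ^ 2 * (3 * H ^ 2)
              ≤ 4 * ρbar * (1728 * L * H ^ 2) * (1 + A) ^ 2 +
                16 * ρbar ^ 2 * (3 * (2 * (H ^ 2 * L))) * (1 + A) ^ 2 := by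
                refine add_le_add (by gcongr) ?_
                refine le_trans (by gcongr) (le_mul_of_one_le_right (by positivity) hA2)
            _ = (6912 * ρbar + 96 * ρbar ^ 2) * (1 + A) ^ 2 * H ^ 2 * L := by ring
            _ ≤ _ := by gcongr; linarith
  rw [lintegral_enorm_pow_eq f four_ne_zero, Nat.cast_ofNat] at h4
  have hf4 : MemLp f 4 μ := by
    refine ⟨hfm, lt_top_iff_ne_top.2 fun htop => ?_⟩
    rw [htop] at h4
    simp at h4
  refine ⟨hf4, ?_⟩
  rw [← ofReal_lpNorm hf4, ← ENNReal.ofReal_pow lpNorm_nonneg] at h4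
  have hL0 : 0 ≤ L := by linarith
  have h5 := (ENNReal.ofReal_le_ofReal_iff (by positivity)).1 h4
  refine le_of_pow_le_pow_left₀ two_ne_zero (by positivity) ?_
  calc (normLp 4 cylinderExterior f ^ 2) ^ 2 = lpNorm f 4 μ ^ 4 := by
        rw [← pow_mul]; rfl
    _ ≤ C₀ * (1 + A) ^ 2 * H ^ 2 * L := h5
    _ = (Real.sqrt C₀ * (1 + A) * H * Real.sqrt L) ^ 2 := by
        rw [mul_pow, mul_pow, mul_pow, Real.sq_sqrt hC₀pos.le, Real.sq_sqrt hL0]
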